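/- Setting (Single-Lane Partition, SLP). Vehicles form a homogeneous Poisson point process on $\mathbb R$ of density $\lambda>0$. Each vehicle is active, independently, with a fixed probability $p_a\in(0,1]$ that does not depend on $n_{\rm AR}$. Let $d_{\mathcal A},d_{\max},\tau,\alpha,\rho_{\rm VT},\gamma,r_{\rm bc}>0$ and $\sigma_n^2\ge 0$. With $n_{\rm AR}$ access resources, the co-channel segments of the probe segment are $\mathcal A_c=[\,c\,n_{\rm AR}d_{\mathcal A}-\tfrac{d_{\mathcal A}}2,\;c\,n_{\rm AR}d_{\mathcal A}+\tfrac{d_{\mathcal A}}2)$, $c\in\mathbb Z$, and $\mathcal A_0=[-\tfrac{d_{\mathcal A}}2,\tfrac{d_{\mathcal A}}2)$ is the probe segment. Fading power gains $H$ of different links are independent, exponential with mean $1$, and independent of the positions; positions, activity and fading are mutually independent. For a probe transmitter ${\rm VT}_0$ and a receiver at $x$, $$\mathrm{SINR}(x)=\frac{H_{{\rm VT}_0}(\tau|{\rm VT}_0-x|)^{-\alpha}\rho_{\rm VT}}{I(x)+\sigma_n^2},\qquad I(x)=\sum_{{\rm VT}_i}H_{{\rm VT}_i}(\tau|{\rm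 VT}_i-x|)^{-\alpha}\rho_{\rm VT},$$ where the sum is over the active vehicles ${\rm VT}_i\neq{\rm VT}_0$ with ${\rm VT}_i\in\bigcup_{c}\mathcal A_c$ and $|{\rm VT}_i-x|\le d_{\max}$. The capture probability $\bar F_{\mathrm{SINR}({\rm VT}_0+r_{\rm bc})}(\gamma)$ is the probability that $\mathrm{SINR}({\rm VT}_0+r_{\rm bc})>\gamma$ for the typical active vehicle ${\rm VT}_0$ of $\mathcal A_0$ (Palm probability: the mean number of active vehicles in $\mathcal A_0$ with this property divided by the mean number of active vehicles in $\mathcal A_0$). For $c=0$ put $\mu_U^{(1)}=\min(\tfrac{d_{\mathcal A}}2-x,d_{\max})$, $\mu_U^{(2)}=-\max(-\tfrac{d_{\mathcal A}}2-x,-d_{\max})$, $\mu_L^{(1)}=\max(-\mu_U^{(2)},0)$, $\mu_L^{(2)}=-\min(\mu_U^{(1)},0)$, and $$\kappa(0,s,x)=\sum_{j\in\{1,2\}}\mathbf 1(\mu_L^{(j)}<\mu_U^{(j)})\Big(F(\mu_U^{(j)})-F(\mu_L^{(j)})\Big),\quad F(u)=u\;{}_2F_1\Big(1,\tfrac1\alpha;1+\tfrac1\alpha;\tfrac{(\tau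 u)^\alpha}{-s\rho_{\rm VT}}\Big),$$ with the principal branch of the Gauss hypergeometric function. Claim. As $n_{\rm AR}\to\infty$, $$\lim_{n_{\rm AR}\to\infty}\bar F_{\mathrm{SINR}({\rm VT}_0+r_{\rm bc})}(\gamma)=\frac{e^{-\frac{\gamma\sigma_n^2}{\rho_{\rm VT}}(\tau r_{\rm bc})^\alpha}}{d_{\mathcal A}}\int_{-d_{\mathcal A}/2}^{d_{\mathcal A}/2}\exp\Big(-\lambda p_a\,\kappa\big(0,\tfrac{\gamma}{\rho_{\rm VT}}(\tau r_{\rm bc})^\alpha,v+r_{\rm bc}\big)\Big)\,dv .$$ Moreover only intra-segment interference survives: for all sufficiently large $n_{\rm AR}$ and every probe transmitter ${\rm VT}_0\in\mathcal A_0$, the interference $I({\rm VT}_0+r_{\rm bc})$ equals the contribution of the active vehicles ${\rm VT}_i\ne{\rm VT}_0$ in $\mathcal A_0$ (the segment $c=0$). -/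

import Mathlib

open MeasureTheory ProbabilityTheory Filter Topology Set
open scoped ENNReal

noncomputable section

/-! ### The Gauss hypergeometric function on its principal branch -/

/-- The complex plane cut along `[1, ∞)`. -/
def hypDomain : Set ℂ := {z : ℂ | 1 - z ∈ Complex.slitPlane}

/-- `f` is the principal branch of the Gauss hypergeometric function with parameters `a, b, c`:
it is holomorphic on the plane cut along `[1, ∞)`, and equal to the hypergeometric series on the
open unit disc. -/
def IsPrincipalHyp (a b c : ℂ) (f : ℂ → ℂ) : Prop :=
  AnalyticOnNhd ℂ f hypDomain ∧ ∀ z : ℂ, ‖z‖ < 1 → f z = ordinaryHypergeometric a b c z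

/-- The principal branch is unique on the cut plane, so `gaussHyp` below is well defined. -/
theorem IsPrincipalHyp.eqOn {a b c : ℂ} {f g : ℂ → ℂ} (hf : IsPrincipalHyp a b c f)
    (hg : IsPrincipalHyp a b c g) : EqOn f g hypDomain := by
  have h0 : (0 : ℂ) ∈ hypDomain := by simp [hypDomain]
  have hstar : StarConvex ℝ (0 : ℂ) hypDomain := by
    intro z hz s t hs ht hst
    have h1 := Complex.starConvex_one_slitPlane hz hs ht hst
    have h2 : s • (1 : ℂ) + t • (1 - z) = 1 - (s • (0 : ℂ) + t • z) := by
      have : (s : ℂ) + t = 1 := by exact_mod_cast hst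
      simp only [Complex.real_smul]
      linear_combination this
    rw [h2] at h1
    exact h1
  refine hf.1.eqOn_of_preconnected_of_eventuallyEq hg.1
    (hstar.isPathConnected h0).isConnected.isPreconnected h0 ?_
  filter_upwards [Metric.ball_mem_nhds (0 : ℂ) one_pos] with z hz
  have hz' : ‖z‖ < 1 := by simpa using hz
  rw [hf.2 z hz', hg.2 z hz']

open Classical in
/-- The Gauss hypergeometric function `₂F₁(a, b; c; z)`: the sum of the hypergeometric series on
the unit disc, continued analytically to the plane cut along `[1, ∞)`. -/
def gaussHyp (a b c z : ℂ) : ℂ :=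
  if h : ∃ f : ℂ → ℂ, IsPrincipalHyp a b c f then h.choose z else 0

/-! ### Poisson point process and the network -/

/-- The number of points of the enumerated point configuration `x` that lie in `B`. -/
def countIn (x : ℕ → ℝ) (B : Set ℝ) : ℕ∞ := {i : ℕ | x i ∈ B}.encard

/-- The random points `X 0, X 1, …` form a homogeneous Poisson point process on the real line with
density `lam`: the numbers of points in pairwise disjoint bounded Borel sets `B j` are independent
Poisson random variables with means `lam * |B j|`. -/
structure IsPoissonProcess {Ω : Type*} [MeasurableSpace Ω] (P : Measure Ω) (lam : ℝ)
    (X : ℕ → Ω → ℝ) : Prop where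
  measurable : ∀ i, Measurable (X i)
  counts : ∀ (m : ℕ) (B : Fin m → Set ℝ), (∀ j, MeasurableSet (B j)) →
    (∀ j, Bornology.IsBounded (B j)) → Pairwise (fun j k => Disjoint (B j) (B k)) →
    ∀ k : Fin m → ℕ,
      P {ω | ∀ j, countIn (fun i => X i ω) (B j) = (k j : ℕ∞)} =
        ∏ j, ENNReal.ofReal (Real.exp (-(lam * (volume (B j)).toReal)) *
          (lam * (volume (B j)).toReal) ^ k j / (k j).factorial)

/-- The random elements of the Single-Lane Partition network. Vehicle `i` is at `X i`, it has data
to transmit iff `act i` is true, and `H i j` is the power gain of the fading on the link from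
vehicle `j` to the receiver of vehicle `i`. The positions form a Poisson process of density `lam`,
the vehicles are active independently with probability `pa`, the gains of the links are
independent and exponential with mean one, and positions, activity and fading are mutually
independent. -/
structure IsSLPNetwork {Ω : Type*} [MeasurableSpace Ω] (P : Measure Ω) (lam pa : ℝ)
    (X : ℕ → Ω → ℝ) (act : ℕ → Ω → Bool) (H : ℕ → ℕ → Ω → ℝ) : Prop where
  poisson : IsPoissonProcess P lam X
  act_measurable : ∀ i, Measurable (act i)
  act_prob : ∀ i, P {ω | act i ω = true} = ENNReal.ofReal pa
  act_indep : iIndepFun act P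
  gain_measurable : ∀ i j, Measurable (H i j)
  gain_law : ∀ i j, P.map (H i j) = expMeasure 1
  gain_indep : iIndepFun (fun (l : ℕ × ℕ) ω => H l.1 l.2 ω) P
  indep_act_gain : IndepFun (fun ω i => act i ω) (fun ω (l : ℕ × ℕ) => H l.1 l.2 ω) P
  indep_position : IndepFun (fun ω i => X i ω)
    (fun ω => ((fun i => act i ω), (fun l : ℕ × ℕ => H l.1 l.2 ω))) P

/-- The deterministic system parameters. -/
structure SLPParams where
  /-- density of vehicles (the density per lane times the number of lanes) -/
  lam : ℝ
  /-- probability that a vehicle is active -/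
  pa : ℝ
  /-- segment length -/
  dA : ℝ
  /-- maximum communication distance -/
  dmax : ℝ
  /-- path loss slope -/
  τ : ℝ
  /-- path loss exponent -/
  α : ℝ
  /-- transmit power per Hz -/
  ρ : ℝ
  /-- square root of the noise power -/
  σn : ℝ
  /-- SINR threshold -/
  γ : ℝ
  /-- distance from the probe transmitter to its receiver -/
  rbc : ℝ
  lam_pos : 0 < lam
  pa_pos : 0 < pa
  pa_le_one : pa ≤ 1
  dA_pos : 0 < dA
  dmax_pos : 0 < dmax
  τ_pos : 0 < τ
  α_pos : 0 < α
  ρ_pos : 0 < ρ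
  γ_pos : 0 < γ
  rbc_pos : 0 < rbc

namespace SLPParams

variable (p : SLPParams)

/-- The `c`-th co-channel segment `[c n dA - dA/2, c n dA + dA/2)` of the probe access resource,
with `n` access resources. -/
def segment (n : ℕ) (c : ℤ) : Set ℝ :=
  Ico (c * n * p.dA - p.dA / 2) (c * n * p.dA + p.dA / 2)

/-- The probe segment `[-dA/2, dA/2)`. -/
def probeSegment : Set ℝ := Ico (-(p.dA / 2)) (p.dA / 2)

/-- All the segments that use the probe access resource. -/
def coChannel (n : ℕ) : Set ℝ := ⋃ c : ℤ, p.segment n c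

/-- Path loss factor `(τ r)^(-α)` at distance `r`. -/
def pathGain (r : ℝ) : ℝ≥0∞ := ENNReal.ofReal (p.τ * r) ^ (-p.α)

open Classical in
/-- Interference at `x` when vehicle `i` is the probe transmitter, for positions `x'`, activities
`a` and link gains `h` towards the receiver of vehicle `i`: total power received from the active
vehicles other than `i` that lie in the set `S` and within the maximum distance of `x`. -/
def interference (S : Set ℝ) (x' : ℕ → ℝ) (a : ℕ → Bool) (h : ℕ → ℝ) (i : ℕ) (x : ℝ) : ℝ≥0∞ :=
  ∑' j : ℕ, if j ≠ i ∧ a j = true ∧ x' j ∈ S ∧ x' j ∈ Metric.closedBall x p.dmax then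
    ENNReal.ofReal (h j) * p.pathGain |x' j - x| * ENNReal.ofReal p.ρ else 0

/-- SINR at `x` when vehicle `i` is the probe transmitter and there are `n` access resources. The
value is in `[0, ∞]`, and it is infinite if a positive signal meets neither noise nor
interference. -/
def sinr (n : ℕ) (x' : ℕ → ℝ) (a : ℕ → Bool) (h : ℕ → ℝ) (i : ℕ) (x : ℝ) : ℝ≥0∞ :=
  ENNReal.ofReal (h i) * p.pathGain |x' i - x| * ENNReal.ofReal p.ρ /
    (p.interference (p.coChannel n) x' a h i x + ENNReal.ofReal (p.σn ^ 2))

/-- Capture probability with `n` access resources: the probability that the SINR exceeds `γ` at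
distance `rbc` from the typical active transmitter of the probe segment. Probabilities for the
typical point are Palm probabilities: the mean number of active vehicles `VT` in the probe segment
with `SINR(VT + rbc) > γ`, divided by the mean number of active vehicles in the probe segment. -/
def captureProb {Ω : Type*} [MeasurableSpace Ω] (P : Measure Ω) (X : ℕ → Ω → ℝ)
    (act : ℕ → Ω → Bool) (H : ℕ → ℕ → Ω → ℝ) (n : ℕ) : ℝ≥0∞ :=
  (∫⁻ ω, ({i : ℕ | act i ω = true ∧ X i ω ∈ p.probeSegment ∧
      ENNReal.ofReal p.γ <
        p.sinr n (fun j => X j ω) (fun j => act j ω) (fun j => H i j ω) i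
          (X i ω + p.rbc)}.encard : ℝ≥0∞) ∂P) /
  (∫⁻ ω, ({i : ℕ | act i ω = true ∧ X i ω ∈ p.probeSegment}.encard : ℝ≥0∞) ∂P)

/-! ### The function `κ`

`ξ` is the centre of a segment; the `c`-th co-channel segment has `ξ = c n dA`, so that `c = 0` is
`ξ = 0` for every `n`. The vehicles to the right (`j = 1`) and to the left (`j = 2`) of the
receiver `x` that are in the segment and within the maximum distance are those at a distance
between `muL j` and `muU j`. -/

/-- Right end of the segment, relative to `x`, cut at `dmax`. -/
def muU1 (ξ x : ℝ) : ℝ := min (ξ + p.dA / 2 - x) p.dmax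

/-- Minus the left end of the segment, relative to `x`, cut at `-dmax`. -/
def muU2 (ξ x : ℝ) : ℝ := -max (ξ - p.dA / 2 - x) (-p.dmax)

/-- Least distance of the part to the right of `x`. -/
def muL1 (ξ x : ℝ) : ℝ := max (-p.muU2 ξ x) 0

/-- Least distance of the part to the left of `x`. -/
def muL2 (ξ x : ℝ) : ℝ := -min (p.muU1 ξ x) 0

/-- `u ₂F₁(1, 1/α; 1 + 1/α; (τ u)^α / (-s ρ))`. -/
def kappaTerm (s u : ℝ) : ℝ :=
  u * (gaussHyp 1 (1 / p.α : ℝ) (1 + 1 / p.α : ℝ) ((p.τ * u) ^ p.α / (-(s * p.ρ)) : ℝ)).re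

open Classical in
/-- The function `κ` for the segment with centre `ξ`, at the Laplace variable `s` and the
receiver position `x`. -/
def kappa (ξ s x : ℝ) : ℝ :=
  (if p.muL1 ξ x < p.muU1 ξ x then
    p.kappaTerm s (p.muU1 ξ x) - p.kappaTerm s (p.muL1 ξ x) else 0) +
  (if p.muL2 ξ x < p.muU2 ξ x then
    p.kappaTerm s (p.muU2 ξ x) - p.kappaTerm s (p.muL2 ξ x) else 0)

end SLPParams

end

noncomputable section

theorem isOpen_hypDomain : IsOpen hypDomain :=
  Complex.isOpen_slitPlane.preimage (continuous_const.sub continuous_id)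

theorem one_sub_mul_ne_zero_of_mem_hypDomain {z : ℂ} (hz : z ∈ hypDomain) {w : ℝ}
    (hw : w ∈ Icc (0 : ℝ) 1) : 1 - z * w ≠ 0 := by
  have h := Complex.starConvex_one_slitPlane hz (a := 1 - w) (b := w) (by linarith [hw.2]) hw.1
    (by ring)
  have h2 : (1 - w) • (1 : ℂ) + w • (1 - z) = 1 - z * w := by
    simp only [Complex.real_smul]; push_cast; ring
  rw [h2] at h
  exact Complex.slitPlane_ne_zero h

/-- Euler's integral for `₂F₁(1, 1/α; 1 + 1/α; z)`, after the substitution `t = v ^ α`. -/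
def eulerHyp (α : ℝ) (z : ℂ) : ℂ := ∫ v in (0 : ℝ)..1, (1 - z * ((v ^ α : ℝ) : ℂ))⁻¹

theorem rpow_mem_Icc {α v : ℝ} (hα : 0 < α) (hv : v ∈ Icc (0 : ℝ) 1) : v ^ α ∈ Icc (0 : ℝ) 1 :=
  ⟨Real.rpow_nonneg hv.1 _, Real.rpow_le_one hv.1 hv.2 hα.le⟩

theorem continuousOn_eulerHyp_integrand {α : ℝ} (hα : 0 < α) {z : ℂ} (hz : z ∈ hypDomain) :
    ContinuousOn (fun v : ℝ => (1 - z * ((v ^ α : ℝ) : ℂ))⁻¹) (Icc 0 1) := by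
  have hc : Continuous fun v : ℝ => v ^ α :=
    continuous_iff_continuousAt.2 fun v => Real.continuousAt_rpow_const _ _ (Or.inr hα.le)
  refine ContinuousOn.inv₀ (by fun_prop) fun v hv => ?_
  exact one_sub_mul_ne_zero_of_mem_hypDomain hz (rpow_mem_Icc hα hv)

theorem differentiableAt_eulerHyp {α : ℝ} (hα : 0 < α) {z₀ : ℂ} (hz₀ : z₀ ∈ hypDomain) :
    DifferentiableAt ℂ (eulerHyp α) z₀ := by
  have hc : Continuous fun v : ℝ => v ^ α :=
    continuous_iff_continuousAt.2 fun v => Real.continuousAt_rpow_const _ _ (Or.inr hα.le)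
  obtain ⟨r, hr, hball⟩ := Metric.nhds_basis_closedBall.mem_iff.1 (isOpen_hypDomain.mem_nhds hz₀)
  have hcont : ContinuousOn (fun q : ℂ × ℝ => (q.2 : ℂ) / (1 - q.1 * (q.2 : ℂ)) ^ 2)
      (Metric.closedBall z₀ r ×ˢ Icc 0 1) := by
    refine ContinuousOn.div (by fun_prop) (by fun_prop) fun q hq => ?_
    exact pow_ne_zero _ (one_sub_mul_ne_zero_of_mem_hypDomain (hball hq.1) hq.2)
  obtain ⟨C, hC⟩ := ((isCompact_closedBall z₀ r).prod isCompact_Icc).exists_bound_of_continuousOn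
    hcont
  have hsub : ∀ v ∈ uIoc (0 : ℝ) 1, v ∈ Icc (0 : ℝ) 1 := fun v hv => by
    rw [uIoc_of_le zero_le_one] at hv; exact Ioc_subset_Icc_self hv
  have key := intervalIntegral.hasDerivAt_integral_of_dominated_loc_of_deriv_le
    (𝕜 := ℂ) (μ := volume) (a := 0) (b := 1) (bound := fun _ => C)
    (F := fun z (v : ℝ) => (1 - z * ((v ^ α : ℝ) : ℂ))⁻¹)
    (F' := fun z (v : ℝ) => ((v ^ α : ℝ) : ℂ) / (1 - z * ((v ^ α : ℝ) : ℂ)) ^ 2)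
    (x₀ := z₀) (Metric.closedBall_mem_nhds z₀ hr) ?_ ?_ ?_ ?_ ?_ ?_
  · exact key.2.differentiableAt
  · filter_upwards [Metric.closedBall_mem_nhds z₀ hr] with z hz
    refine ((continuousOn_eulerHyp_integrand hα (hball hz)).mono hsub).aestronglyMeasurable
      measurableSet_uIoc
  · refine ContinuousOn.intervalIntegrable ?_
    rw [uIcc_of_le zero_le_one]
    exact continuousOn_eulerHyp_integrand hα hz₀
  · refine Measurable.aestronglyMeasurable ?_
    have := hc.measurable
    fun_prop
  · refine Eventually.of_forall fun v hv z hz => ?_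
    exact hC (z, v ^ α) ⟨hz, rpow_mem_Icc hα (hsub v hv)⟩
  · simp
  · refine Eventually.of_forall fun v hv z hz => ?_
    have hne := one_sub_mul_ne_zero_of_mem_hypDomain (hball hz) (rpow_mem_Icc hα (hsub v hv))
    have h1 : HasDerivAt (fun z : ℂ => 1 - z * ((v ^ α : ℝ) : ℂ)) (-((v ^ α : ℝ) : ℂ)) z := by
      simpa using ((hasDerivAt_id z).mul_const ((v ^ α : ℝ) : ℂ)).const_sub 1
    have h2 := h1.inv hne
    rw [neg_neg] at h2
    exact h2

theorem ascPochhammer_eval_div_eval_add_one {b : ℂ} (hb : 0 < b.re) (n : ℕ) :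
    (ascPochhammer ℂ n).eval b * ((ascPochhammer ℂ n).eval (1 + b))⁻¹ = b / (b + n) := by
  have hne : ∀ k : ℕ, b + k ≠ 0 := fun k h => by
    have := congrArg Complex.re h
    simp at this
    have : (0 : ℝ) ≤ k := k.cast_nonneg
    linarith
  induction n with
  | zero => simpa using (div_self (by simpa using hne 0)).symm
  | succ n ih =>
    rw [ascPochhammer_succ_eval, ascPochhammer_succ_eval, mul_inv, mul_mul_mul_comm, ih]
    have h1 := hne n
    have h2 := hne (n + 1)
    push_cast at h2 ⊢
    have h3 : 1 + b + (n : ℂ) ≠ 0 := by rw [add_comm 1 b, add_assoc, add_comm 1 (n : ℂ)]; exact h2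
    field_simp
    ring

theorem eulerHyp_eq_ordinaryHypergeometric {α : ℝ} (hα : 0 < α) {z : ℂ} (hz : ‖z‖ < 1) :
    eulerHyp α z = ordinaryHypergeometric (1 : ℂ) ((1 / α : ℝ) : ℂ) ((1 + 1 / α : ℝ) : ℂ) z := by
  have hc : Continuous fun v : ℝ => v ^ α :=
    continuous_iff_continuousAt.2 fun v => Real.continuousAt_rpow_const _ _ (Or.inr hα.le)
  have hsub : ∀ v ∈ uIoc (0 : ℝ) 1, v ∈ Icc (0 : ℝ) 1 := fun v hv => by
    rw [uIoc_of_le zero_le_one] at hv; exact Ioc_subset_Icc_self hv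
  have hle : ∀ v ∈ uIoc (0 : ℝ) 1, ‖z * ((v ^ α : ℝ) : ℂ)‖ ≤ ‖z‖ := fun v hv => by
    have := rpow_mem_Icc hα (hsub v hv)
    rw [norm_mul, Complex.norm_real, Real.norm_of_nonneg this.1]
    exact mul_le_of_le_one_right (norm_nonneg _) this.2
  have hsum := intervalIntegral.hasSum_integral_of_dominated_convergence
    (μ := volume) (a := 0) (b := 1)
    (F := fun (n : ℕ) (v : ℝ) => (z * ((v ^ α : ℝ) : ℂ)) ^ n)
    (f := fun v : ℝ => (1 - z * ((v ^ α : ℝ) : ℂ))⁻¹) (fun n _ => ‖z‖ ^ n) ?_ ?_ ?_ ?_ ?_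
  · rw [eulerHyp, ← hsum.tsum_eq, ordinaryHypergeometric_eq_tsum]
    refine tsum_congr fun n => ?_
    have h_int : ∫ v in (0 : ℝ)..1, (z * ((v ^ α : ℝ) : ℂ)) ^ n = z ^ n * ((1 / (α * n + 1) : ℝ) : ℂ) := by
      have h0 : ∫ v in (0 : ℝ)..1, (z * ((v ^ α : ℝ) : ℂ)) ^ n =
          ∫ v in (0 : ℝ)..1, z ^ n * ((v ^ (α * n) : ℝ) : ℂ) := by
        refine intervalIntegral.integral_congr fun v hv => ?_
        rw [uIcc_of_le zero_le_one] at hv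
        rw [mul_pow, Real.rpow_mul hv.1, Real.rpow_natCast]
        push_cast
        rfl
      have hpos : 0 ≤ α * n := by positivity
      rw [h0, intervalIntegral.integral_const_mul, intervalIntegral.integral_ofReal,
        integral_rpow (Or.inl (by linarith))]
      rw [Real.one_rpow, Real.zero_rpow (by linarith), sub_zero]
    rw [h_int, ascPochhammer_eval_one, smul_eq_mul, mul_assoc (((n.factorial : ℕ) : ℂ)⁻¹ * _)]
    have hb : 0 < (((1 / α : ℝ) : ℂ)).re := by rw [Complex.ofReal_re]; positivity
    have h2 := ascPochhammer_eval_div_eval_add_one hb n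
    have h3 : ((1 + 1 / α : ℝ) : ℂ) = 1 + ((1 / α : ℝ) : ℂ) := by push_cast; ring
    rw [h3, h2]
    have h4 : ((n.factorial : ℕ) : ℂ) ≠ 0 := by exact_mod_cast n.factorial_ne_zero
    have h5 : (1 : ℝ) / (α * n + 1) = (1 / α) / (1 / α + n) := by
      field_simp
      ring
    rw [h5]
    push_cast
    rw [inv_mul_cancel₀ h4, one_mul, mul_comm]
  · intro n
    refine Measurable.aestronglyMeasurable ?_
    have := hc.measurable
    fun_prop
  · refine fun n => Eventually.of_forall fun v hv => ?_
    rw [norm_pow]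
    exact pow_le_pow_left₀ (norm_nonneg _) (hle v hv) _
  · exact Eventually.of_forall fun v hv => summable_geometric_of_lt_one (norm_nonneg _) hz
  · simp
  · exact Eventually.of_forall fun v hv => hasSum_geometric_of_norm_lt_one ((hle v hv).trans_lt hz)

theorem isPrincipalHyp_eulerHyp {α : ℝ} (hα : 0 < α) :
    IsPrincipalHyp 1 ((1 / α : ℝ) : ℂ) ((1 + 1 / α : ℝ) : ℂ) (eulerHyp α) := by
  refine ⟨?_, fun z hz => eulerHyp_eq_ordinaryHypergeometric hα hz⟩
  refine DifferentiableOn.analyticOnNhd (fun z hz => ?_) isOpen_hypDomain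
  exact (differentiableAt_eulerHyp hα hz).differentiableWithinAt

theorem gaussHyp_eq_eulerHyp {α : ℝ} (hα : 0 < α) {z : ℂ} (hz : z ∈ hypDomain) :
    gaussHyp 1 ((1 / α : ℝ) : ℂ) ((1 + 1 / α : ℝ) : ℂ) z = eulerHyp α z := by
  have h : ∃ f : ℂ → ℂ, IsPrincipalHyp 1 ((1 / α : ℝ) : ℂ) ((1 + 1 / α : ℝ) : ℂ) f :=
    ⟨_, isPrincipalHyp_eulerHyp hα⟩
  rw [gaussHyp, dif_pos h]
  exact h.choose_spec.eqOn (isPrincipalHyp_eulerHyp hα) hz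

namespace SLPParams

variable (p : SLPParams)

/-- The interference weight at distance `t`: the complement of the Laplace transform at `s` of the
power received from a transmitter at distance `t`. -/
def weight (s t : ℝ) : ℝ := s * p.ρ / (s * p.ρ + (p.τ * t) ^ p.α)

theorem weight_denom_pos {s t : ℝ} (hs : 0 < s) (ht : 0 ≤ t) :
    0 < s * p.ρ + (p.τ * t) ^ p.α := by
  have := p.ρ_pos
  have := p.τ_pos
  positivity

theorem weight_nonneg {s t : ℝ} (hs : 0 < s) (ht : 0 ≤ t) : 0 ≤ p.weight s t :=
  div_nonneg (mul_nonneg hs.le p.ρ_pos.le) (p.weight_denom_pos hs ht).le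

theorem weight_le_one {s t : ℝ} (hs : 0 < s) (ht : 0 ≤ t) : p.weight s t ≤ 1 := by
  refine (div_le_one (p.weight_denom_pos hs ht)).2 ?_
  have := p.τ_pos
  have : 0 ≤ (p.τ * t) ^ p.α := by positivity
  linarith

theorem continuousOn_weight {s : ℝ} (hs : 0 < s) : ContinuousOn (p.weight s) (Ici 0) := by
  have hc : Continuous fun v : ℝ => v ^ p.α :=
    continuous_iff_continuousAt.2 fun v => Real.continuousAt_rpow_const _ _ (Or.inr p.α_pos.le)
  refine ContinuousOn.div (by fun_prop) ?_ fun t ht => (p.weight_denom_pos hs ht).ne'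
  exact (continuous_const.add (hc.comp (continuous_const.mul continuous_id))).continuousOn

theorem kappaTerm_eq_integral {s u : ℝ} (hs : 0 < s) (hu : 0 ≤ u) :
    p.kappaTerm s u = ∫ t in (0 : ℝ)..u, p.weight s t := by
  have hρ := p.ρ_pos
  have hτ := p.τ_pos
  have hα := p.α_pos
  set q : ℝ := (p.τ * u) ^ p.α / (-(s * p.ρ)) with hq
  have hq0 : q ≤ 0 := by
    rw [hq, div_neg]
    have : 0 ≤ (p.τ * u) ^ p.α / (s * p.ρ) := by positivity
    linarith
  have hdom : (q : ℂ) ∈ hypDomain := by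
    have : (1 - (q : ℂ)) = ((1 - q : ℝ) : ℂ) := by push_cast; ring
    rw [hypDomain, mem_ofPred_eq, this, Complex.ofReal_mem_slitPlane]
    linarith
  have h1 : eulerHyp p.α q = ((∫ v in (0 : ℝ)..1, (1 - q * v ^ p.α)⁻¹ : ℝ) : ℂ) := by
    rw [eulerHyp, ← intervalIntegral.integral_ofReal]
    push_cast
    rfl
  have h2 : p.kappaTerm s u = u * ∫ v in (0 : ℝ)..1, (1 - q * v ^ p.α)⁻¹ := by
    have := gaussHyp_eq_eulerHyp hα hdom
    rw [kappaTerm]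
    push_cast at this ⊢
    rw [hq] at this
    push_cast at this
    rw [this]
    have h1' := h1
    rw [hq] at h1'
    push_cast at h1'
    rw [h1', ← hq, Complex.ofReal_re]
  rw [h2]
  have h3 : ∫ v in (0 : ℝ)..1, (1 - q * v ^ p.α)⁻¹ = ∫ v in (0 : ℝ)..1, p.weight s (u * v) := by
    refine intervalIntegral.integral_congr fun v hv => ?_
    rw [uIcc_of_le zero_le_one] at hv
    have h4 : (p.τ * (u * v)) ^ p.α = (p.τ * u) ^ p.α * v ^ p.α := by
      rw [← mul_assoc, Real.mul_rpow (by positivity) hv.1]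
    have h5 := p.weight_denom_pos hs (mul_nonneg hu hv.1)
    simp only [weight, h4, hq] at h5 ⊢
    have h6 : 1 - (p.τ * u) ^ p.α / (-(s * p.ρ)) * v ^ p.α =
      (s * p.ρ + (p.τ * u) ^ p.α * v ^ p.α) / (s * p.ρ) := by field_simp; ring
    rw [h6, inv_div]
  rw [h3, intervalIntegral.mul_integral_comp_mul_left]
  simp

/-- For the probe segment, `κ` is the
integral of the weight over the vehicles of the segment within the maximum distance. -/
theorem kappa_zero_eq_integral {s : ℝ} (hs : 0 < s) (y : ℝ) :
    p.kappa 0 s y = ∫ x in p.probeSegment,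
      (Metric.closedBall y p.dmax).indicator (fun x => p.weight s |x - y|) x := by
  have hd := p.dmax_pos
  have hA := p.dA_pos
  have hcw := p.continuousOn_weight hs
  have h_int : ∀ {a b : ℝ}, 0 ≤ a → 0 ≤ b → IntervalIntegrable (p.weight s) volume a b :=
    fun ha hb => (hcw.mono fun x hx => (le_min ha hb).trans hx.1).intervalIntegrable
  have hterm : ∀ {a b : ℝ}, 0 ≤ a → a < b →
      p.kappaTerm s b - p.kappaTerm s a = ∫ t in a..b, p.weight s t := by
    intro a b ha hab
    rw [p.kappaTerm_eq_integral hs ha, p.kappaTerm_eq_integral hs (ha.trans hab.le)]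
    exact intervalIntegral.integral_interval_sub_left (h_int le_rfl (ha.trans hab.le))
      (h_int le_rfl ha)
  have hcont : Continuous fun x => p.weight s |x - y| :=
    hcw.comp_continuous (by fun_prop) fun x => abs_nonneg (x - y)
  have h_intOn : ∀ a b : ℝ, IntegrableOn (fun x => p.weight s |x - y|) (Ioc a b) :=
    fun a b => (hcont.integrableOn_Icc (a := a) (b := b)).mono_set Ioc_subset_Icc_self
  set a : ℝ := max (0 - p.dA / 2 - y) (-p.dmax) with ha
  set b : ℝ := min (0 + p.dA / 2 - y) p.dmax with hb
  have hset : (p.probeSegment ∩ Metric.closedBall y p.dmax : Set ℝ) =ᵐ[volume] Ioc (y + a) (y + b) := by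
    have h1 : p.probeSegment =ᵐ[volume] Ioc (-(p.dA / 2)) (p.dA / 2) := Ico_ae_eq_Ioc
    have h2 : Metric.closedBall y p.dmax =ᵐ[volume] Ioc (y - p.dmax) (y + p.dmax) := by
      rw [Real.closedBall_eq_Icc]; exact Ioc_ae_eq_Icc.symm
    have h3 : Ioc (y + a) (y + b) = Ioc (-(p.dA / 2)) (p.dA / 2) ∩ Ioc (y - p.dmax) (y + p.dmax) := by
      rw [Ioc_inter_Ioc, ha, hb, ← max_add_add_left, ← min_add_add_left]
      congr 1 <;> congr 1 <;> ring
    rw [h3]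
    exact h1.inter h2
  rw [setIntegral_indicator Metric.isClosed_closedBall.measurableSet, setIntegral_congr_set hset]
  have hR : (if p.muL1 0 y < p.muU1 0 y then
      p.kappaTerm s (p.muU1 0 y) - p.kappaTerm s (p.muL1 0 y) else 0) =
      ∫ x in Ioc (y + max a 0) (y + b), p.weight s |x - y| := by
    have e1 : p.muL1 0 y = max a 0 := by simp [muL1, muU2, ha]
    have e2 : p.muU1 0 y = b := rfl
    rw [e1, e2]
    split_ifs with h
    · rw [hterm (le_max_right _ _) h, ← intervalIntegral.integral_of_le (by linarith)]
      have := intervalIntegral.integral_comp_sub_right (a := y + max a 0) (b := y + b)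
        (fun t => p.weight s |t|) y
      rw [this]
      simp only [add_sub_cancel_left]
      refine intervalIntegral.integral_congr fun t ht => ?_
      rw [uIcc_of_le h.le] at ht
      rw [abs_of_nonneg ((le_max_right a 0).trans ht.1)]
    · rw [Ioc_eq_empty (by linarith), setIntegral_empty]
  have hL : (if p.muL2 0 y < p.muU2 0 y then
      p.kappaTerm s (p.muU2 0 y) - p.kappaTerm s (p.muL2 0 y) else 0) =
      ∫ x in Ioc (y + a) (y + min b 0), p.weight s |x - y| := by
    have e1 : p.muL2 0 y = -min b 0 := rfl
    have e2 : p.muU2 0 y = -a := rfl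
    rw [e1, e2]
    split_ifs with h
    · rw [hterm (by linarith [min_le_right b 0]) h, ← intervalIntegral.integral_of_le (by linarith)]
      have := intervalIntegral.integral_comp_sub_left (a := y + a) (b := y + min b 0)
        (fun t => p.weight s |t|) y
      have h7 : ∀ x, |y - x| = |x - y| := fun x => abs_sub_comm _ _
      simp only [h7] at this
      rw [this]
      simp only [sub_add_cancel_left]
      refine intervalIntegral.integral_congr fun t ht => ?_
      rw [uIcc_of_le h.le] at ht
      rw [abs_of_nonneg (le_trans (by linarith [min_le_right b 0]) ht.1)]
    · rw [Ioc_eq_empty (by linarith), setIntegral_empty]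
  rw [kappa, hR, hL, add_comm, ← setIntegral_union _ measurableSet_Ioc (h_intOn _ _) (h_intOn _ _)]
  · congr 2
    ext x
    simp only [mem_union, mem_Ioc]
    rcases le_total x y with h | h
    · constructor
      · rintro (h1 | h1)
        · exact ⟨h1.1, h1.2.trans (by linarith [min_le_left b 0])⟩
        · exact absurd h1.1 (by linarith [le_max_right a 0])
      · rintro ⟨h1, h2⟩
        exact Or.inl ⟨h1, by rcases min_choice b 0 with h3 | h3 <;> rw [h3] <;> linarith⟩
    · constructor
      · rintro (h1 | h1)
        · exact ⟨h1.1, h1.2.trans (by linarith [min_le_left b 0])⟩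
        · exact ⟨by linarith [h1.1, le_max_left a 0], h1.2⟩
      · rintro ⟨h1, h2⟩
        rcases h.eq_or_lt with h3 | h3
        · exact Or.inl ⟨h1, by rcases min_choice b 0 with h3 | h3 <;> rw [h3] <;> linarith⟩
        · exact Or.inr ⟨by rcases max_choice a 0 with h3 | h3 <;> rw [h3] <;> linarith, h2⟩
  · refine Set.disjoint_left.2 fun x h1 h2 => ?_
    linarith [h1.2, h2.1, min_le_right b 0, le_max_right a 0]

end SLPParams

theorem lintegral_poissonMeasure (r : NNReal) {u : ℕ → ℝ} (hu : ∀ n, 0 ≤ u n) {c : ℝ}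
    (hc : HasSum (fun n => u n * (Real.exp (-r) * r ^ n / n.factorial)) c) :
    ∫⁻ n, ENNReal.ofReal (u n) ∂(poissonMeasure r) = ENNReal.ofReal c := by
  rw [lintegral_countable', ← hc.tsum_eq, ENNReal.ofReal_tsum_of_nonneg _ hc.summable]
  · refine tsum_congr fun n => ?_
    rw [poissonMeasure_singleton, ENNReal.ofReal_mul (hu n)]
  · exact fun n => mul_nonneg (hu n) (by positivity)

theorem hasSum_pow_mul_poisson (r a : ℝ) :
    HasSum (fun n : ℕ => a ^ n * (Real.exp (-r) * r ^ n / n.factorial))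
      (Real.exp (r * (a - 1))) := by
  have h := (NormedSpace.expSeries_div_hasSum_exp (r * a)).mul_left (Real.exp (-r))
  rw [← Real.exp_eq_exp_ℝ, ← Real.exp_add] at h
  have e : -r + r * a = r * (a - 1) := by ring
  rw [e] at h
  refine h.congr_fun fun n => ?_
  rw [mul_pow]; ring

theorem hasSum_natCast_mul_pow_mul_poisson (r a : ℝ) :
    HasSum (fun n : ℕ => (n * a ^ (n - 1)) * (Real.exp (-r) * r ^ n / n.factorial))
      (r * Real.exp (r * (a - 1))) := by
  rw [← hasSum_nat_add_iff' 1]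
  simp only [Finset.range_one, Finset.sum_singleton, Nat.cast_zero, zero_mul, sub_zero]
  refine ((hasSum_pow_mul_poisson r a).mul_left r).congr_fun fun n => ?_
  rw [Nat.add_sub_cancel, Nat.factorial_succ]
  have h1 : ((n + 1 : ℕ) : ℝ) ≠ 0 := by positivity
  have h2 : (n.factorial : ℝ) ≠ 0 := by positivity
  push_cast at h1 ⊢
  field_simp
  ring

section Counts

variable {Ω : Type*} [MeasurableSpace Ω] {P : Measure Ω} {lam : ℝ} {X : ℕ → Ω → ℝ}

open Classical in
theorem countIn_toENNReal (x : ℕ → ℝ) (B : Set ℝ) :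
    ((countIn x B : ℕ∞) : ℝ≥0∞) = ∑' i, if x i ∈ B then 1 else 0 := by
  rw [countIn, ← ENNReal.tsum_set_one, tsum_subtype {i | x i ∈ B} fun _ => (1 : ℝ≥0∞)]
  refine tsum_congr fun i => ?_
  simp [indicator_apply]

theorem measurable_countIn_toENNReal (hX : ∀ i, Measurable (X i)) {B : Set ℝ}
    (hB : MeasurableSet B) :
    Measurable fun ω => ((countIn (fun i => X i ω) B : ℕ∞) : ℝ≥0∞) := by
  simp only [countIn_toENNReal]
  exact Measurable.tsum fun i =>
    Measurable.ite (hX i hB) measurable_const measurable_const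

theorem measurableSet_countIn_eq (hX : ∀ i, Measurable (X i)) {B : Set ℝ}
    (hB : MeasurableSet B) (k : ℕ∞) : MeasurableSet {ω | countIn (fun i => X i ω) B = k} := by
  have h := measurable_countIn_toENNReal hX hB (measurableSet_singleton (k : ℝ≥0∞))
  convert h using 1
  ext ω
  simp

theorem measurable_toNat_countIn (hX : ∀ i, Measurable (X i)) {B : Set ℝ}
    (hB : MeasurableSet B) : Measurable fun ω => (countIn (fun i => X i ω) B).toNat := by
  refine measurable_to_countable' fun n => ?_
  have : (fun ω => (countIn (fun i => X i ω) B).toNat) ⁻¹' {n} =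
      ⋃ k ∈ {k : ℕ∞ | k.toNat = n}, {ω | countIn (fun i => X i ω) B = k} := by
    ext ω; simp
  rw [this]
  exact MeasurableSet.biUnion (to_countable _) fun k _ => measurableSet_countIn_eq hX hB k

namespace IsPoissonProcess

theorem ae_countIn_ne_top [IsProbabilityMeasure P] (hX : IsPoissonProcess P lam X)
    (hlam : 0 ≤ lam) {B : Set ℝ} (hB : MeasurableSet B) (hb : Bornology.IsBounded B) :
    ∀ᵐ ω ∂P, countIn (fun i => X i ω) B ≠ ⊤ := by
  have hk : ∀ k : ℕ, P {ω | countIn (fun i => X i ω) B = k} =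
      poissonMeasure (lam * (volume B).toReal).toNNReal {k} := fun k => by
    have h := hX.counts 1 (fun _ => B) (fun _ => hB) (fun _ => hb)
      (fun i j hij => absurd (Subsingleton.elim i j) hij) (fun _ => k)
    simp only [forall_const, Finset.univ_unique, Finset.prod_singleton] at h
    rw [h, poissonMeasure_singleton, Real.coe_toNNReal _ (by positivity)]
  have hu : P (⋃ k : ℕ, {ω | countIn (fun i => X i ω) B = k}) = 1 := by
    rw [measure_iUnion]
    · simp only [hk]
      have h1 := lintegral_countable' (μ := poissonMeasure (lam * (volume B).toReal).toNNReal)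
        fun _ => 1
      rw [lintegral_one, measure_univ] at h1
      simpa using h1.symm
    · intro i j hij
      refine Set.disjoint_left.2 fun ω h1 h2 => hij ?_
      have : (i : ℕ∞) = j := h1.symm.trans h2
      exact_mod_cast this
    · exact fun k => measurableSet_countIn_eq hX.measurable hB _
  have hm : MeasurableSet (⋃ k : ℕ, {ω | countIn (fun i => X i ω) B = k}) :=
    MeasurableSet.iUnion fun k => measurableSet_countIn_eq hX.measurable hB _
  have hae := (prob_compl_eq_zero_iff hm).2 hu
  filter_upwards [compl_mem_ae_iff.2 hae] with ω hω
  rw [compl_compl, mem_iUnion] at hω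
  obtain ⟨k, hk⟩ := hω
  rw [show countIn (fun i => X i ω) B = k from hk]
  exact ENat.natCast_ne_top k

theorem ae_finite [IsProbabilityMeasure P] (hX : IsPoissonProcess P lam X)
    (hlam : 0 ≤ lam) {B : Set ℝ} (hB : MeasurableSet B) (hb : Bornology.IsBounded B) :
    ∀ᵐ ω ∂P, {i | X i ω ∈ B}.Finite := by
  filter_upwards [hX.ae_countIn_ne_top hlam hB hb] with ω hω
  exact Set.encard_ne_top_iff.1 hω

theorem map_counts [IsProbabilityMeasure P] (hX : IsPoissonProcess P lam X)
    (hlam : 0 ≤ lam) {m : ℕ} {B : Fin m → Set ℝ} (hB : ∀ j, MeasurableSet (B j))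
    (hb : ∀ j, Bornology.IsBounded (B j)) (hd : Pairwise fun j k => Disjoint (B j) (B k)) :
    P.map (fun ω j => (countIn (fun i => X i ω) (B j)).toNat) =
      Measure.pi fun j => poissonMeasure (lam * (volume (B j)).toReal).toNNReal := by
  have hmeas : Measurable fun ω j => (countIn (fun i => X i ω) (B j)).toNat :=
    measurable_pi_lambda _ fun j => measurable_toNat_countIn hX.measurable (hB j)
  refine Measure.ext_iff_singleton.2 fun k => ?_
  rw [Measure.pi_singleton, Measure.map_apply hmeas (measurableSet_singleton k)]
  have h := hX.counts m B hB hb hd k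
  have h2 : P ((fun ω j => (countIn (fun i => X i ω) (B j)).toNat) ⁻¹' {k}) =
      P {ω | ∀ j, countIn (fun i => X i ω) (B j) = (k j : ℕ∞)} := by
    refine measure_congr ?_
    have hfin : ∀ᵐ ω ∂P, ∀ j, countIn (fun i => X i ω) (B j) ≠ ⊤ :=
      ae_all_iff.2 fun j => hX.ae_countIn_ne_top hlam (hB j) (hb j)
    filter_upwards [hfin] with ω hω
    refine propext ?_
    change (fun j => (countIn (fun i => X i ω) (B j)).toNat) = k ↔ _
    rw [funext_iff]
    refine forall_congr' fun j => ?_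
    rw [← ENat.natCast_inj, ENat.natCast_toNat (hω j)]
  rw [h2, h]
  refine Finset.prod_congr rfl fun j _ => ?_
  rw [poissonMeasure_singleton, Real.coe_toNNReal _ (by positivity)]

end IsPoissonProcess

end Counts

theorem lintegral_pi_prod_eval {m : ℕ} (ν : Fin m → Measure ℕ) [∀ j, IsProbabilityMeasure (ν j)]
    (u : Fin m → ℕ → ℝ≥0∞) :
    ∫⁻ n, ∏ j, u j (n j) ∂(Measure.pi ν) = ∏ j, ∫⁻ n, u j n ∂(ν j) := by
  have hind : iIndepFun (fun j (n : Fin m → ℕ) => u j (n j)) (Measure.pi ν) :=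
    iIndepFun_pi fun j => (measurable_of_countable (u j)).aemeasurable
  rw [lintegral_prod_eq_prod_lintegral_of_indepFun _ _ hind fun j =>
    (measurable_of_countable (u j)).comp (measurable_pi_apply j)]
  refine Finset.prod_congr rfl fun j _ => ?_
  exact (measurePreserving_eval ν j).lintegral_comp (measurable_of_countable (u j))

/-- The sum over the points of a configuration in `A` of the product of `f` over the pairs formed
with the other points in `A`; it is zero if there are infinitely many points in `A`. -/
def pairSum (A : Set ℝ) (f : ℝ → ℝ → ℝ) (x : ℕ → ℝ) : ℝ≥0∞ := by
  classical
  exact if h : {i | x i ∈ A}.Finite then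
    ENNReal.ofReal (∑ i ∈ h.toFinset, ∏ j ∈ h.toFinset.erase i, f (x i) (x j)) else 0

theorem pairSum_of_finite {A : Set ℝ} (f : ℝ → ℝ → ℝ) {x : ℕ → ℝ} (h : {i | x i ∈ A}.Finite) :
    pairSum A f x =
      ENNReal.ofReal (∑ i ∈ h.toFinset, ∏ j ∈ h.toFinset.erase i, f (x i) (x j)) := by
  simp only [pairSum, dif_pos h]

theorem pairSum_mono {A : Set ℝ} {f g : ℝ → ℝ → ℝ} (hf : ∀ y ∈ A, ∀ x ∈ A, 0 ≤ f y x)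
    (hfg : ∀ y ∈ A, ∀ x ∈ A, f y x ≤ g y x) (x : ℕ → ℝ) : pairSum A f x ≤ pairSum A g x := by
  by_cases h : {i | x i ∈ A}.Finite
  · rw [pairSum_of_finite f h, pairSum_of_finite g h]
    refine ENNReal.ofReal_le_ofReal (Finset.sum_le_sum fun i hi => ?_)
    rw [Set.Finite.mem_toFinset] at hi
    refine Finset.prod_le_prod (fun j hj => ?_) fun j hj => ?_ <;>
    · have := Finset.mem_of_mem_erase hj
      rw [Set.Finite.mem_toFinset] at this
      first | exact hf _ hi _ this | exact hfg _ hi _ this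
  · simp [pairSum, h]

theorem pairSum_step {A : Set ℝ} {m : ℕ} (κ : ℝ → Fin m) (φ : Fin m → Fin m → ℝ) {x : ℕ → ℝ}
    (h : {i | x i ∈ A}.Finite) :
    pairSum A (fun y x => φ (κ y) (κ x)) x = ENNReal.ofReal (∑ k, ∏ l,
      if l = k then ((countIn x (A ∩ κ ⁻¹' {l})).toNat : ℝ) *
          φ k l ^ ((countIn x (A ∩ κ ⁻¹' {l})).toNat - 1)
        else φ k l ^ (countIn x (A ∩ κ ⁻¹' {l})).toNat) := by
  rw [pairSum_of_finite _ h]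
  set T := h.toFinset with hT
  have hcard : ∀ l, (countIn x (A ∩ κ ⁻¹' {l})).toNat = (T.filter fun i => κ (x i) = l).card := by
    intro l
    have : {i | x i ∈ A ∩ κ ⁻¹' {l}} = ((T.filter fun i => κ (x i) = l : Finset ℕ) : Set ℕ) := by
      ext i; simp [hT]
    rw [countIn, this, Set.encard_coe_eq_coe_finsetCard, ENat.toNat_natCast]
  simp only [hcard]
  congr 1
  have hprod : ∀ i ∈ T, ∏ j ∈ T.erase i, φ (κ (x i)) (κ (x j)) =
      ∏ l, φ (κ (x i)) l ^ (if l = κ (x i) then (T.filter fun i => κ (x i) = l).card - 1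
        else (T.filter fun i => κ (x i) = l).card) := by
    intro i hi
    rw [← Finset.prod_fiberwise (T.erase i) (fun j => κ (x j))]
    refine Finset.prod_congr rfl fun l _ => ?_
    rw [Finset.prod_congr rfl (g := fun _ => φ (κ (x i)) l)
      (fun j hj => by rw [(Finset.mem_filter.1 hj).2]), Finset.prod_const, Finset.filter_erase]
    congr 1
    split_ifs with hl
    · rw [Finset.card_erase_of_mem]
      simp [hi, hl]
    · rw [Finset.erase_eq_of_notMem]
      simp [Ne.symm hl]
  rw [Finset.sum_congr rfl hprod, ← Finset.sum_fiberwise T (fun j => κ (x j))]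
  refine Finset.sum_congr rfl fun k _ => ?_
  rw [Finset.sum_congr rfl (g := fun _ => ∏ l, φ k l ^
      (if l = k then (T.filter fun i => κ (x i) = l).card - 1
        else (T.filter fun i => κ (x i) = l).card))
    (fun j hj => by rw [(Finset.mem_filter.1 hj).2]), Finset.sum_const, nsmul_eq_mul]
  have h1 : ((T.filter fun i => κ (x i) = k).card : ℝ) =
      ∏ l, if l = k then ((T.filter fun i => κ (x i) = l).card : ℝ) else 1 := by simp
  rw [h1, ← Finset.prod_mul_distrib]
  refine Finset.prod_congr rfl fun l _ => ?_
  split_ifs <;> simp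

section Mecke

variable {Ω : Type*} [MeasurableSpace Ω] {P : Measure Ω} {lam : ℝ} {X : ℕ → Ω → ℝ}

namespace IsPoissonProcess

theorem lintegral_pairSum_step [IsProbabilityMeasure P] (hX : IsPoissonProcess P lam X)
    (hlam : 0 ≤ lam) {A : Set ℝ} (hA : MeasurableSet A) (hb : Bornology.IsBounded A) {m : ℕ}
    {κ : ℝ → Fin m} (hκ : Measurable κ) {φ : Fin m → Fin m → ℝ} (hφ : ∀ k l, 0 ≤ φ k l) :
    ∫⁻ ω, pairSum A (fun y x => φ (κ y) (κ x)) (fun i => X i ω) ∂P =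
      ∫⁻ y in A, ENNReal.ofReal
        (lam * Real.exp (-(lam * ∫ x in A, (1 - φ (κ y) (κ x))))) := by
  set B : Fin m → Set ℝ := fun l => A ∩ κ ⁻¹' {l} with hBdef
  have hBm : ∀ l, MeasurableSet (B l) := fun l => hA.inter (hκ (measurableSet_singleton l))
  have hBb : ∀ l, Bornology.IsBounded (B l) := fun l => hb.subset inter_subset_left
  have hBd : Pairwise fun j k => Disjoint (B j) (B k) := by
    intro j k hjk
    refine Set.disjoint_left.2 fun x h1 h2 => hjk ?_
    exact (h1.2 : κ x = j).symm.trans h2.2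
  set μ : Fin m → ℝ := fun l => lam * (volume (B l)).toReal with hμ
  have hμ0 : ∀ l, 0 ≤ μ l := fun l => by positivity
  set u : Fin m → Fin m → ℕ → ℝ := fun k l n =>
    if l = k then (n : ℝ) * φ k l ^ (n - 1) else φ k l ^ n with hu
  have hu0 : ∀ k l n, 0 ≤ u k l n := fun k l n => by
    have := hφ k l
    simp only [hu]; split_ifs <;> positivity
  have hN : Measurable fun ω j => (countIn (fun i => X i ω) (B j)).toNat :=
    measurable_pi_lambda _ fun j => measurable_toNat_countIn hX.measurable (hBm j)
  have h1 : ∫⁻ ω, pairSum A (fun y x => φ (κ y) (κ x)) (fun i => X i ω) ∂P =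
      ∫⁻ ω, ∑ k, ∏ l, ENNReal.ofReal (u k l (countIn (fun i => X i ω) (B l)).toNat) ∂P := by
    refine lintegral_congr_ae ?_
    filter_upwards [hX.ae_finite hlam hA hb] with ω hω
    rw [pairSum_step κ φ hω, ENNReal.ofReal_sum_of_nonneg]
    · refine Finset.sum_congr rfl fun k _ => ?_
      rw [ENNReal.ofReal_prod_of_nonneg fun l _ => hu0 k l _]
    · exact fun k _ => Finset.prod_nonneg fun l _ => hu0 k l _
  have h2 : ∫⁻ ω, ∑ k, ∏ l, ENNReal.ofReal (u k l (countIn (fun i => X i ω) (B l)).toNat) ∂P =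
      ∑ k, ∏ l, ∫⁻ n, ENNReal.ofReal (u k l n) ∂(poissonMeasure (μ l).toNNReal) := by
    rw [← lintegral_map (f := fun n : Fin m → ℕ => ∑ k, ∏ l, ENNReal.ofReal (u k l (n l)))
      (measurable_of_countable _) hN, hX.map_counts hlam hBm hBb hBd,
      lintegral_finsetSum _ fun k _ => measurable_of_countable _]
    exact Finset.sum_congr rfl fun k _ =>
      lintegral_pi_prod_eval _ fun l n => ENNReal.ofReal (u k l n)
  have h3 : ∀ k, ∏ l, ∫⁻ n, ENNReal.ofReal (u k l n) ∂(poissonMeasure (μ l).toNNReal) =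
      ENNReal.ofReal (μ k * Real.exp (∑ l, μ l * (φ k l - 1))) := by
    intro k
    have h4 : ∀ l, ∫⁻ n, ENNReal.ofReal (u k l n) ∂(poissonMeasure (μ l).toNNReal) =
        ENNReal.ofReal ((if l = k then μ l else 1) * Real.exp (μ l * (φ k l - 1))) := by
      intro l
      refine lintegral_poissonMeasure _ (hu0 k l) ?_
      rw [Real.coe_toNNReal _ (hμ0 l)]
      by_cases hl : l = k
      · simp only [hu, if_pos hl]
        exact hasSum_natCast_mul_pow_mul_poisson _ _
      · simp only [hu, if_neg hl, one_mul]
        exact hasSum_pow_mul_poisson _ _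
    rw [Finset.prod_congr rfl fun l _ => h4 l, ← ENNReal.ofReal_prod_of_nonneg,
      Finset.prod_mul_distrib, Real.exp_sum]
    · simp
    · intro l _
      have := hμ0 l
      split_ifs <;> positivity
  have hvol : volume A ≠ ⊤ := hb.measure_lt_top.ne
  have : IsFiniteMeasure (volume.restrict A) := ⟨by simpa using hvol.lt_top⟩
  have hmapr : ∀ l, ((volume.restrict A).map κ) {l} = volume (B l) := fun l => by
    rw [Measure.map_apply hκ (measurableSet_singleton l),
      Measure.restrict_apply (hκ (measurableSet_singleton l)), inter_comm]
  have h5 : ∀ k, ∫ x in A, (1 - φ k (κ x)) = ∑ l, (volume (B l)).toReal * (1 - φ k l) := by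
    intro k
    rw [← integral_map (f := fun l => 1 - φ k l) hκ.aemeasurable
      (measurable_of_countable _).aestronglyMeasurable, integral_fintype .of_finite]
    refine Finset.sum_congr rfl fun l _ => ?_
    rw [measureReal_def, hmapr, smul_eq_mul]
  rw [h1, h2, ← lintegral_map (f := fun k => ENNReal.ofReal
      (lam * Real.exp (-(lam * ∫ x in A, (1 - φ k (κ x)))))) (measurable_of_countable _) hκ,
    lintegral_fintype]
  refine Finset.sum_congr rfl fun k _ => ?_
  rw [h3, h5, hmapr, ← ENNReal.ofReal_toReal (a := volume (B k)) (hBb k).measure_lt_top.ne,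
    ← ENNReal.ofReal_mul (by positivity)]
  congr 1
  have h6 : ∑ l, μ l * (φ k l - 1) = -(lam * ∑ l, (volume (B l)).toReal * (1 - φ k l)) := by
    rw [Finset.mul_sum, ← Finset.sum_neg_distrib]
    refine Finset.sum_congr rfl fun l _ => ?_
    simp only [hμ]; ring
  rw [h6]
  simp only [hμ]
  ring

end IsPoissonProcess

/-- The index of the cell of `x` in the partition of `[a, b)` into `m + 1` equal cells. -/
def cellIndex (a b : ℝ) (m : ℕ) (x : ℝ) : Fin (m + 1) :=
  ⟨min m ⌊(x - a) / (b - a) * (m + 1)⌋₊, Nat.lt_succ_of_le (min_le_left _ _)⟩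

theorem measurable_cellIndex (a b : ℝ) (m : ℕ) : Measurable (cellIndex a b m) := by
  have h : Measurable fun x : ℝ => ⌊(x - a) / (b - a) * (m + 1)⌋₊ :=
    Nat.measurable_floor.comp (by fun_prop)
  have h2 : Measurable fun n : ℕ =>
    (⟨min m n, Nat.lt_succ_of_le (min_le_left _ _)⟩ : Fin (m + 1)) := measurable_of_countable _
  exact h2.comp h

theorem abs_sub_le_of_cellIndex_eq {a b : ℝ} (hab : a < b) {m : ℕ} {x y : ℝ} (hx : x ∈ Ico a b)
    (hy : y ∈ Ico a b) (h : cellIndex a b m x = cellIndex a b m y) :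
    |x - y| ≤ (b - a) / (m + 1) := by
  have hba : 0 < b - a := sub_pos.2 hab
  have hm : (0 : ℝ) < m + 1 := by positivity
  have key : ∀ z ∈ Ico a b, 0 ≤ (z - a) / (b - a) * (m + 1) ∧
      ⌊(z - a) / (b - a) * (m + 1)⌋₊ ≤ m := fun z hz => by
    have h0 : 0 ≤ (z - a) / (b - a) * (m + 1) :=
      mul_nonneg (div_nonneg (by linarith [hz.1]) hba.le) hm.le
    refine ⟨h0, Nat.lt_succ_iff.1 ((Nat.floor_lt h0).2 ?_)⟩
    push_cast
    have : (z - a) / (b - a) < 1 := (div_lt_one hba).2 (by linarith [hz.2])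
    nlinarith
  have hx' := key x hx
  have hy' := key y hy
  have h1 : ⌊(x - a) / (b - a) * (m + 1)⌋₊ = ⌊(y - a) / (b - a) * (m + 1)⌋₊ := by
    have := congrArg Fin.val h
    simpa [cellIndex, min_eq_right hx'.2, min_eq_right hy'.2] using this
  have e1 := Nat.floor_le hx'.1
  have e2 := Nat.lt_floor_add_one ((x - a) / (b - a) * (m + 1))
  have e3 := Nat.floor_le hy'.1
  have e4 := Nat.lt_floor_add_one ((y - a) / (b - a) * (m + 1))
  rw [h1] at e1 e2
  have h2 : |(x - a) / (b - a) * (m + 1) - (y - a) / (b - a) * (m + 1)| ≤ 1 := by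
    rw [abs_le]; constructor <;> linarith
  have h3 : (x - a) / (b - a) * (m + 1) - (y - a) / (b - a) * (m + 1) =
      (x - y) * ((m + 1) / (b - a)) := by field_simp; ring
  rw [h3, abs_mul, abs_of_pos (div_pos hm hba)] at h2
  rw [le_div_iff₀ hm]
  rw [← mul_div_assoc, div_le_one hba] at h2
  exact h2

/-- The values of `f` on the product of the cells `k` and `l`. -/
def cellValues (a b : ℝ) (m : ℕ) (f : ℝ → ℝ → ℝ) (k l : Fin (m + 1)) : Set ℝ :=
  {t | ∃ y ∈ Ico a b, ∃ x ∈ Ico a b, cellIndex a b m y = k ∧ cellIndex a b m x = l ∧ f y x = t}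

theorem eventually_cellValues_subset {a b : ℝ} (hab : a < b) {f : ℝ → ℝ → ℝ} {y x : ℝ}
    (hy : y ∈ Ico a b) (hx : x ∈ Ico a b)
    (hf : ContinuousAt (fun q : ℝ × ℝ => f q.1 q.2) (y, x)) {ε : ℝ} (hε : 0 < ε) :
    ∀ᶠ m in atTop, cellValues a b m f (cellIndex a b m y) (cellIndex a b m x) ⊆
      Icc (f y x - ε) (f y x + ε) := by
  obtain ⟨δ, hδ, h⟩ := Metric.continuousAt_iff.1 hf ε hε
  have hlim : Tendsto (fun m : ℕ => (b - a) / ((m : ℝ) + 1)) atTop (𝓝 0) :=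
    tendsto_const_nhds.div_atTop (tendsto_atTop_add_const_right _ _ tendsto_natCast_atTop_atTop)
  filter_upwards [hlim.eventually (gt_mem_nhds hδ)] with m hm
  rintro t ⟨y', hy', x', hx', hky, hkx, rfl⟩
  have h1 := abs_sub_le_of_cellIndex_eq hab hy' hy hky
  have h2 := abs_sub_le_of_cellIndex_eq hab hx' hx hkx
  have h3 := @h (y', x') (by
    rw [Prod.dist_eq, max_lt_iff, Real.dist_eq, Real.dist_eq]
    exact ⟨h1.trans_lt hm, h2.trans_lt hm⟩)
  rw [Real.dist_eq, abs_lt] at h3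
  exact ⟨by linarith [h3.1], by linarith [h3.2]⟩

theorem tendsto_lintegral_exp_step {a b : ℝ} (hlam : 0 ≤ lam) {f : ℝ → ℝ → ℝ}
    {φ : (m : ℕ) → Fin (m + 1) → Fin (m + 1) → ℝ} (hφ : ∀ m k l, φ m k l ∈ Icc (0 : ℝ) 1)
    (hlim : ∀ y ∈ Ico a b, ∀ᵐ x, x ∈ Ico a b →
      Tendsto (fun m => φ m (cellIndex a b m y) (cellIndex a b m x)) atTop (𝓝 (f y x))) :
    Tendsto (fun m => ∫⁻ y in Ico a b, ENNReal.ofReal (lam * Real.exp (-(lam *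
        ∫ x in Ico a b, (1 - φ m (cellIndex a b m y) (cellIndex a b m x))))))
      atTop (𝓝 (∫⁻ y in Ico a b, ENNReal.ofReal (lam * Real.exp (-(lam *
        ∫ x in Ico a b, (1 - f y x)))))) := by
  refine tendsto_lintegral_of_dominated_convergence (fun _ => ENNReal.ofReal lam) ?_ ?_ ?_ ?_
  · intro m
    exact (measurable_of_countable fun k => ENNReal.ofReal (lam * Real.exp (-(lam *
        ∫ x in Ico a b, (1 - φ m k (cellIndex a b m x)))))).comp (measurable_cellIndex a b m)
  · refine fun m => Eventually.of_forall fun y => ENNReal.ofReal_le_ofReal ?_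
    refine mul_le_of_le_one_right hlam (Real.exp_le_one_iff.2 (neg_nonpos.2 ?_))
    exact mul_nonneg hlam (integral_nonneg fun x => sub_nonneg.2 (hφ _ _ _).2)
  · rw [setLIntegral_const]
    exact ENNReal.mul_ne_top ENNReal.ofReal_ne_top (by simp)
  · filter_upwards [ae_restrict_mem measurableSet_Ico] with y hy
    refine ENNReal.tendsto_ofReal ?_
    have hin : Tendsto (fun m => ∫ x in Ico a b,
        (1 - φ m (cellIndex a b m y) (cellIndex a b m x))) atTop
        (𝓝 (∫ x in Ico a b, (1 - f y x))) := by
      refine tendsto_integral_of_dominated_convergence (fun _ => (1 : ℝ)) ?_ ?_ ?_ ?_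
      · intro m
        exact ((measurable_of_countable fun l => 1 - φ m (cellIndex a b m y) l).comp
          (measurable_cellIndex a b m)).aestronglyMeasurable
      · simp
      · refine fun m => Eventually.of_forall fun x => ?_
        have := hφ m (cellIndex a b m y) (cellIndex a b m x)
        rw [Real.norm_of_nonneg (sub_nonneg.2 this.2)]
        linarith [this.1]
      · refine (ae_restrict_iff' measurableSet_Ico).2 ?_
        filter_upwards [hlim y hy] with x hx hxm
        exact (hx hxm).const_sub 1
    exact ((Real.continuous_exp.tendsto _).comp (hin.const_mul lam).neg).const_mul lam

/-- Mecke's formula for the sum over the points of a Poisson process in an interval of the product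
of a function over the pairs formed with the other points in the interval. -/
theorem IsPoissonProcess.lintegral_pairSum [IsProbabilityMeasure P] (hX : IsPoissonProcess P lam X)
    (hlam : 0 ≤ lam) {a b : ℝ} (hab : a < b) {f : ℝ → ℝ → ℝ}
    (hf : ∀ y x, f y x ∈ Icc (0 : ℝ) 1)
    (hc : ∀ y, ∀ᵐ x, ContinuousAt (fun q : ℝ × ℝ => f q.1 q.2) (y, x)) :
    ∫⁻ ω, pairSum (Ico a b) f (fun i => X i ω) ∂P =
      ∫⁻ y in Ico a b, ENNReal.ofReal
        (lam * Real.exp (-(lam * ∫ x in Ico a b, (1 - f y x)))) := by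
  have hsub : ∀ m k l, cellValues a b m f k l ⊆ Icc 0 1 := by
    rintro m k l _ ⟨y, -, x, -, -, -, rfl⟩
    exact hf y x
  have hbdd : ∀ m k l, BddAbove (cellValues a b m f k l) ∧ BddBelow (cellValues a b m f k l) :=
    fun m k l => ⟨bddAbove_Icc.mono (hsub m k l), bddBelow_Icc.mono (hsub m k l)⟩
  have hmem : ∀ m, ∀ y ∈ Ico a b, ∀ x ∈ Ico a b,
      f y x ∈ cellValues a b m f (cellIndex a b m y) (cellIndex a b m x) :=
    fun m y hy x hx => ⟨y, hy, x, hx, rfl, rfl, rfl⟩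
  have hU : ∀ m k l, sSup (cellValues a b m f k l) ∈ Icc (0 : ℝ) 1 := fun m k l =>
    ⟨Real.sSup_nonneg fun t ht => (hsub m k l ht).1,
      Real.sSup_le (fun t ht => (hsub m k l ht).2) zero_le_one⟩
  have hL : ∀ m k l, sInf (cellValues a b m f k l) ∈ Icc (0 : ℝ) 1 := fun m k l => by
    refine ⟨Real.sInf_nonneg fun t ht => (hsub m k l ht).1, ?_⟩
    rcases (cellValues a b m f k l).eq_empty_or_nonempty with h | ⟨t, ht⟩
    · rw [h, Real.sInf_empty]; exact zero_le_one
    · exact (csInf_le (hbdd m k l).2 ht).trans (hsub m k l ht).2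
  have hlimU : ∀ y ∈ Ico a b, ∀ᵐ x, x ∈ Ico a b → Tendsto (fun m =>
      sSup (cellValues a b m f (cellIndex a b m y) (cellIndex a b m x))) atTop (𝓝 (f y x)) := by
    intro y hy
    filter_upwards [hc y] with x hcx hx
    refine Metric.tendsto_nhds.2 fun ε hε => ?_
    filter_upwards [eventually_cellValues_subset hab hy hx hcx (half_pos hε)] with m hm
    have h1 := le_csSup (hbdd m _ _).1 (hmem m y hy x hx)
    have h2 := csSup_le ⟨_, hmem m y hy x hx⟩ fun t ht => (hm ht).2
    rw [Real.dist_eq, abs_lt]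
    constructor <;> linarith
  have hlimL : ∀ y ∈ Ico a b, ∀ᵐ x, x ∈ Ico a b → Tendsto (fun m =>
      sInf (cellValues a b m f (cellIndex a b m y) (cellIndex a b m x))) atTop (𝓝 (f y x)) := by
    intro y hy
    filter_upwards [hc y] with x hcx hx
    refine Metric.tendsto_nhds.2 fun ε hε => ?_
    filter_upwards [eventually_cellValues_subset hab hy hx hcx (half_pos hε)] with m hm
    have h1 := csInf_le (hbdd m _ _).2 (hmem m y hy x hx)
    have h2 := le_csInf ⟨_, hmem m y hy x hx⟩ fun t ht => (hm ht).1
    rw [Real.dist_eq, abs_lt]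
    constructor <;> linarith
  refine le_antisymm ?_ ?_
  · refine ge_of_tendsto' (tendsto_lintegral_exp_step hlam hU hlimU) fun m => ?_
    rw [← hX.lintegral_pairSum_step hlam measurableSet_Ico (Metric.isBounded_Ico a b)
      (measurable_cellIndex a b m) fun k l => (hU m k l).1]
    refine lintegral_mono fun ω => pairSum_mono (fun y _ x _ => (hf y x).1) ?_ _
    exact fun y hy x hx => le_csSup (hbdd m _ _).1 (hmem m y hy x hx)
  · refine le_of_tendsto' (tendsto_lintegral_exp_step hlam hL hlimL) fun m => ?_
    rw [← hX.lintegral_pairSum_step hlam measurableSet_Ico (Metric.isBounded_Ico a b)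
      (measurable_cellIndex a b m) fun k l => (hL m k l).1]
    refine lintegral_mono fun ω => pairSum_mono (fun y _ x _ => (hL m _ _).1) ?_ _
    exact fun y hy x hx => csInf_le (hbdd m _ _).2 (hmem m y hy x hx)

end Mecke

open Classical in
theorem encard_toENNReal_eq_tsum {ι : Type*} (q : ι → Prop) :
    (({i | q i}.encard : ℕ∞) : ℝ≥0∞) = ∑' i, if q i then 1 else 0 := by
  rw [← ENNReal.tsum_set_one, tsum_subtype {i | q i} fun _ => (1 : ℝ≥0∞)]
  exact tsum_congr fun i => by simp [indicator_apply]

/-- The function `t ↦ exp (-t)` on `[0, ∞]`. -/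
def expNeg (t : ℝ≥0∞) : ℝ≥0∞ := if t = ⊤ then 0 else ENNReal.ofReal (Real.exp (-t.toReal))

@[simp] theorem expNeg_top : expNeg ⊤ = 0 := if_pos rfl

theorem expNeg_of_ne_top {t : ℝ≥0∞} (ht : t ≠ ⊤) :
    expNeg t = ENNReal.ofReal (Real.exp (-t.toReal)) := if_neg ht

@[simp] theorem expNeg_zero : expNeg 0 = 1 := by simp [expNeg]

theorem expNeg_ofReal {t : ℝ} (ht : 0 ≤ t) :
    expNeg (ENNReal.ofReal t) = ENNReal.ofReal (Real.exp (-t)) := by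
  rw [expNeg_of_ne_top ENNReal.ofReal_ne_top, ENNReal.toReal_ofReal ht]

theorem expNeg_add (a b : ℝ≥0∞) : expNeg (a + b) = expNeg a * expNeg b := by
  by_cases ha : a = ⊤
  · simp [ha]
  by_cases hb : b = ⊤
  · simp [hb]
  rw [expNeg_of_ne_top ha, expNeg_of_ne_top hb, expNeg_of_ne_top (ENNReal.add_ne_top.2 ⟨ha, hb⟩),
    ENNReal.toReal_add ha hb, neg_add, Real.exp_add, ENNReal.ofReal_mul (Real.exp_pos _).le]

theorem expNeg_sum {ι : Type*} (s : Finset ι) (u : ι → ℝ≥0∞) :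
    expNeg (∑ j ∈ s, u j) = ∏ j ∈ s, expNeg (u j) := by
  classical
  induction s using Finset.induction_on with
  | empty => simp
  | insert j s hj ih => rw [Finset.sum_insert hj, Finset.prod_insert hj, expNeg_add, ih]

theorem measurable_expNeg : Measurable expNeg :=
  Measurable.ite (measurableSet_singleton _) measurable_const (by fun_prop)

theorem measurable_expNeg_mul_ofReal (b : ℝ≥0∞) :
    Measurable fun x : ℝ => expNeg (b * ENNReal.ofReal x) :=
  measurable_expNeg.comp (by fun_prop)

instance : IsProbabilityMeasure (expMeasure 1) := isProbabilityMeasure_expMeasure one_pos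

theorem expMeasure_one_lt_ofReal (t : ℝ≥0∞) :
    expMeasure 1 {x | t < ENNReal.ofReal x} = expNeg t := by
  by_cases ht : t = ⊤
  · simp [ht]
  rw [expNeg_of_ne_top ht]
  have hset : {x : ℝ | t < ENNReal.ofReal x} = (Iic t.toReal)ᶜ := by
    ext x
    rw [mem_ofPred_eq, ENNReal.lt_ofReal_iff_toReal_lt ht, mem_compl_iff, mem_Iic, not_le]
  rw [hset, prob_compl_eq_one_sub measurableSet_Iic, ← ofReal_cdf, cdf_expMeasure_eq one_pos,
    if_pos ENNReal.toReal_nonneg, one_mul, ← ENNReal.ofReal_one, ← ENNReal.ofReal_sub]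
  · rw [sub_sub_cancel]
  · rw [sub_nonneg, Real.exp_le_one_iff]
    exact neg_nonpos.2 ENNReal.toReal_nonneg

theorem lintegral_expNeg_mul_expMeasure_one (b : ℝ≥0∞) :
    ∫⁻ x, expNeg (b * ENNReal.ofReal x) ∂(expMeasure 1) = (1 + b)⁻¹ := by
  have hpos : ∀ᵐ x ∂(expMeasure 1), 0 < x := by
    have h := expMeasure_one_lt_ofReal 0
    have hset : {x : ℝ | 0 < ENNReal.ofReal x} = Ioi 0 := by ext x; simp
    rw [hset, expNeg_zero] at h
    have h2 := (prob_compl_eq_zero_iff (measurableSet_Ioi (a := (0 : ℝ)))).2 h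
    filter_upwards [compl_mem_ae_iff.2 h2] with x hx
    simpa using hx
  by_cases hb : b = ⊤
  · rw [lintegral_congr_ae (g := fun _ => 0)]
    · simp [hb]
    · filter_upwards [hpos] with x hx
      rw [hb, ENNReal.top_mul (by simpa using hx), expNeg_top]
  set r : ℝ := b.toReal with hr
  have hr0 : 0 ≤ r := ENNReal.toReal_nonneg
  have hbr : b = ENNReal.ofReal r := (ENNReal.ofReal_toReal hb).symm
  have hpdf : expMeasure 1 = volume.withDensity (exponentialPDF 1) := rfl
  have hm : ∀ c, Measurable (exponentialPDF c) := fun c =>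
    (measurable_exponentialPDFReal c).ennreal_ofReal
  rw [hpdf, lintegral_withDensity_eq_lintegral_mul _ (hm 1)
    (measurable_expNeg_mul_ofReal b)]
  have h1 : ∀ x, (exponentialPDF 1 * fun x => expNeg (b * ENNReal.ofReal x)) x =
      ENNReal.ofReal (1 + r)⁻¹ * exponentialPDF (1 + r) x := by
    intro x
    rw [Pi.mul_apply]
    rcases lt_or_ge x 0 with hx | hx
    · rw [exponentialPDF_of_neg hx, exponentialPDF_of_neg hx, zero_mul, mul_zero]
    · rw [exponentialPDF_of_nonneg hx, exponentialPDF_of_nonneg hx, hbr, ← ENNReal.ofReal_mul hr0,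
        expNeg_ofReal (mul_nonneg hr0 hx), ← ENNReal.ofReal_mul (by positivity),
        ← ENNReal.ofReal_mul (by positivity)]
      congr 1
      have : 1 + r ≠ 0 := by positivity
      rw [← mul_assoc, inv_mul_cancel₀ this, one_mul, one_mul, ← Real.exp_add]
      ring_nf
  rw [lintegral_congr h1, lintegral_const_mul _ (hm _),
    lintegral_exponentialPDF_eq_one (by positivity), mul_one, hbr,
    ENNReal.ofReal_inv_of_pos (by positivity), ENNReal.ofReal_add zero_le_one hr0,
    ENNReal.ofReal_one]

section Independence

variable {Ω : Type*} [MeasurableSpace Ω] {P : Measure Ω}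

theorem ProbabilityTheory.IndepFun.measure_mem_eq_lintegral [IsProbabilityMeasure P]
    {β γ : Type*} [MeasurableSpace β] [MeasurableSpace γ] {Y : Ω → β} {Z : Ω → γ}
    (h : IndepFun Y Z P) (hY : Measurable Y) (hZ : Measurable Z) {E : Set (β × γ)}
    (hE : MeasurableSet E) :
    P {ω | (Y ω, Z ω) ∈ E} = ∫⁻ ω, P {ω' | (Y ω, Z ω') ∈ E} ∂P := by
  have := Measure.isProbabilityMeasure_map (μ := P) hZ.aemeasurable
  have := Measure.isProbabilityMeasure_map (μ := P) hY.aemeasurable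
  have h1 : P {ω | (Y ω, Z ω) ∈ E} = P.map (fun ω => (Y ω, Z ω)) E :=
    (Measure.map_apply (hY.prodMk hZ) hE).symm
  rw [h1, (indepFun_iff_map_prod_eq_prod_map_map hY.aemeasurable hZ.aemeasurable).1 h,
    Measure.prod_apply hE, lintegral_map (measurable_measure_prodMk_left hE) hY]
  refine lintegral_congr fun ω => ?_
  rw [Measure.map_apply hZ (measurable_prodMk_left hE)]
  rfl

theorem measurable_measure_section [SFinite P]
    {β γ : Type*} [MeasurableSpace β] [MeasurableSpace γ] {Y : Ω → β} {Z : Ω → γ}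
    (hY : Measurable Y) (hZ : Measurable Z) {E : Set (β × γ)} (hE : MeasurableSet E) :
    Measurable fun ω => P {ω' | (Y ω, Z ω') ∈ E} :=
  (measurable_measure_prodMk_left (ν := P)
    (hE.preimage (measurable_fst.prodMk (hZ.comp measurable_snd)))).comp hY

theorem measure_add_sum_mul_lt_exponential [IsProbabilityMeasure P] {h : ℕ → Ω → ℝ}
    (hm : ∀ j, Measurable (h j)) (hlaw : ∀ j, P.map (h j) = expMeasure 1) (hind : iIndepFun h P)
    {i : ℕ} {s : Finset ℕ} (hi : i ∉ s) (b : ℕ → ℝ≥0∞) (N : ℝ≥0∞) :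
    P {ω | N + ∑ j ∈ s, b j * ENNReal.ofReal (h j ω) < ENNReal.ofReal (h i ω)} =
      expNeg N * ∏ j ∈ s, (1 + b j)⁻¹ := by
  set W : Ω → ℝ≥0∞ := fun ω => N + ∑ j ∈ s, b j * ENNReal.ofReal (h j ω) with hW
  have hWm : Measurable W := by fun_prop
  have hWi : IndepFun W (h i) P := by
    have h1 := hind.indepFun_finset s {i} (by simpa using hi) hm
    have hψ : Measurable fun v : ({i} : Finset ℕ) → ℝ => v ⟨i, Finset.mem_singleton_self i⟩ :=
      measurable_pi_apply (⟨i, Finset.mem_singleton_self i⟩ : ({i} : Finset ℕ))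
    have h2 := h1.comp (φ := fun v : s → ℝ => N + ∑ j : s, b j * ENNReal.ofReal (v j))
      (ψ := fun v : ({i} : Finset ℕ) → ℝ => v ⟨i, Finset.mem_singleton_self i⟩)
      (by fun_prop) hψ
    have e : W = (fun v : s → ℝ => N + ∑ j : s, b j * ENNReal.ofReal (v j)) ∘
        fun ω (j : s) => h j ω := by
      funext ω
      simp only [hW, Function.comp]
      rw [Finset.sum_coe_sort s fun j => b j * ENNReal.ofReal (h j ω)]
    rw [e]
    exact h2
  have hE : MeasurableSet {q : ℝ≥0∞ × ℝ | q.1 < ENNReal.ofReal q.2} :=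
    measurableSet_lt measurable_fst (by fun_prop)
  have h3 := hWi.measure_mem_eq_lintegral hWm (hm i) hE
  simp only [mem_ofPred_eq] at h3
  rw [h3]
  have h4 : ∀ ω, P {ω' | W ω < ENNReal.ofReal (h i ω')} = expNeg N *
      ∏ j ∈ s, expNeg (b j * ENNReal.ofReal (h j ω)) := fun ω => by
    rw [← expNeg_sum, ← expNeg_add, ← expMeasure_one_lt_ofReal, ← hlaw i,
      Measure.map_apply (hm i) (measurableSet_lt measurable_const (by fun_prop))]
    rfl
  rw [lintegral_congr h4, lintegral_const_mul]
  · congr 1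
    rw [lintegral_prod_eq_prod_lintegral_of_indepFun s
      (fun j ω => expNeg (b j * ENNReal.ofReal (h j ω)))
      (hind.comp (fun j x => expNeg (b j * ENNReal.ofReal x))
        fun j => measurable_expNeg.comp (by fun_prop))
      fun j => measurable_expNeg.comp (by fun_prop)]
    refine Finset.prod_congr rfl fun j _ => ?_
    rw [← lintegral_expNeg_mul_expMeasure_one, ← hlaw j,
      lintegral_map (measurable_expNeg_mul_ofReal (b j)) (hm j)]
  · exact Finset.measurable_prod _ fun j _ => measurable_expNeg.comp (by fun_prop)

theorem lintegral_comp_bool [IsProbabilityMeasure P] {a : Ω → Bool} (ha : Measurable a) {pa : ℝ}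
    (hpa : 0 ≤ pa) (hp : P {ω | a ω = true} = ENNReal.ofReal pa) (v : Bool → ℝ≥0∞) :
    ∫⁻ ω, v (a ω) ∂P = ENNReal.ofReal pa * v true + ENNReal.ofReal (1 - pa) * v false := by
  have h1 : P.map a {true} = ENNReal.ofReal pa := by
    rw [Measure.map_apply ha (measurableSet_singleton _)]; exact hp
  have h2 : P.map a {false} = ENNReal.ofReal (1 - pa) := by
    have := Measure.isProbabilityMeasure_map (μ := P) ha.aemeasurable
    have h3 : ({false} : Set Bool) = {true}ᶜ := by ext b; simp
    rw [h3, prob_compl_eq_one_sub (measurableSet_singleton _), h1, ENNReal.ofReal_sub _ hpa,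
      ENNReal.ofReal_one]
  rw [← lintegral_map (f := v) (measurable_of_countable v) ha, lintegral_fintype]
  simp [h1, h2, mul_comm]

end Independence

namespace IsSLPNetwork

variable {Ω : Type*} [MeasurableSpace Ω] {P : Measure Ω} {lam pa : ℝ}
  {X : ℕ → Ω → ℝ} {act : ℕ → Ω → Bool} {H : ℕ → ℕ → Ω → ℝ}

theorem measurable_position (hnet : IsSLPNetwork P lam pa X act H) :
    Measurable fun ω i => X i ω := measurable_pi_lambda _ hnet.poisson.measurable

theorem measurable_act (hnet : IsSLPNetwork P lam pa X act H) :
    Measurable fun ω i => act i ω := measurable_pi_lambda _ hnet.act_measurable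

theorem measurable_gain (hnet : IsSLPNetwork P lam pa X act H) :
    Measurable fun ω (l : ℕ × ℕ) => H l.1 l.2 ω :=
  measurable_pi_lambda _ fun l => hnet.gain_measurable l.1 l.2

theorem measure_active_and_lt_gain [IsProbabilityMeasure P] (hpa : pa ∈ Icc (0 : ℝ) 1)
    (hnet : IsSLPNetwork P lam pa X act H) {i : ℕ} {s : Finset ℕ} (hi : i ∉ s)
    (b : ℕ → ℝ≥0∞) (N : ℝ≥0∞) :
    P {ω | act i ω = true ∧ N + ∑ j ∈ s, (if act j ω = true then b j else 0) *
        ENNReal.ofReal (H i j ω) < ENNReal.ofReal (H i i ω)} =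
      ENNReal.ofReal pa * expNeg N *
        ∏ j ∈ s, (ENNReal.ofReal pa * (1 + b j)⁻¹ + ENNReal.ofReal (1 - pa)) := by
  classical
  set E : Set ((ℕ → Bool) × (ℕ × ℕ → ℝ)) := {q | q.1 i = true ∧
    N + ∑ j ∈ s, (if q.1 j = true then b j else 0) * ENNReal.ofReal (q.2 (i, j)) <
      ENNReal.ofReal (q.2 (i, i))} with hEdef
  have hact : ∀ j, MeasurableSet {q : (ℕ → Bool) × (ℕ × ℕ → ℝ) | q.1 j = true} := fun j =>
    measurableSet_eq_fun ((measurable_pi_apply j).comp measurable_fst) measurable_const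
  have hgain : ∀ j, Measurable fun q : (ℕ → Bool) × (ℕ × ℕ → ℝ) =>
      ENNReal.ofReal (q.2 (i, j)) := fun j => by fun_prop
  have hE : MeasurableSet E := by
    refine (hact i).inter (measurableSet_lt ?_ (hgain i))
    refine measurable_const.add (Finset.measurable_sum _ fun j _ => ?_)
    exact (Measurable.ite (hact j) measurable_const measurable_const).mul (hgain j)
  have h1 := hnet.indep_act_gain.measure_mem_eq_lintegral hnet.measurable_act hnet.measurable_gain
    hE
  simp only [hEdef, mem_ofPred_eq] at h1
  rw [h1]
  have hrow : iIndepFun (fun j => H i j) P :=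
    hnet.gain_indep.precomp (g := fun j : ℕ => (i, j)) fun _ _ h => (Prod.mk.inj h).2
  set v : ℕ → Bool → ℝ≥0∞ := fun j a =>
    if j = i then (if a = true then 1 else 0) else (if a = true then (1 + b j)⁻¹ else 1) with hv
  have h2 : ∀ ω, P {ω' | act i ω = true ∧ N + ∑ j ∈ s, (if act j ω = true then b j else 0) *
        ENNReal.ofReal (H i j ω') < ENNReal.ofReal (H i i ω')} =
      expNeg N * ∏ j ∈ insert i s, v j (act j ω) := by
    intro ω
    rw [Finset.prod_insert hi]
    by_cases ha : act i ω = true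
    · simp only [ha, true_and]
      rw [measure_add_sum_mul_lt_exponential (hnet.gain_measurable i) (hnet.gain_law i) hrow hi
        (fun j => if act j ω = true then b j else 0)]
      simp only [hv, if_pos, one_mul]
      congr 1
      refine Finset.prod_congr rfl fun j hj => ?_
      rw [if_neg (ne_of_mem_of_not_mem hj hi)]
      split_ifs <;> simp
    · simp [ha, hv]
  have hvm : ∀ j, Measurable (v j) := fun j => measurable_of_countable _
  rw [lintegral_congr h2, lintegral_const_mul]
  · rw [lintegral_prod_eq_prod_lintegral_of_indepFun (insert i s)
      (fun j ω => v j (act j ω)) (hnet.act_indep.comp v hvm)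
      fun j => (hvm j).comp (hnet.act_measurable j), Finset.prod_insert hi]
    have h3 : ∀ j, ∫⁻ ω, v j (act j ω) ∂P =
      ENNReal.ofReal pa * v j true + ENNReal.ofReal (1 - pa) * v j false := fun j =>
        lintegral_comp_bool (hnet.act_measurable j) hpa.1 (hnet.act_prob j) (v j)
    simp only [h3]
    rw [← mul_assoc, mul_comm (expNeg N)]
    congr 1
    · simp [hv]
    · refine Finset.prod_congr rfl fun j hj => ?_
      simp [hv, ne_of_mem_of_not_mem hj hi]
  · exact Finset.measurable_prod _ fun j _ => (hvm j).comp (hnet.act_measurable j)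

theorem lintegral_encard [IsProbabilityMeasure P] (hnet : IsSLPNetwork P lam pa X act H)
    {E : ℕ → Set ((ℕ → ℝ) × ((ℕ → Bool) × (ℕ × ℕ → ℝ)))} (hE : ∀ i, MeasurableSet (E i)) :
    ∫⁻ ω, (({i | ((fun j => X j ω), ((fun j => act j ω),
        fun l : ℕ × ℕ => H l.1 l.2 ω)) ∈ E i}.encard : ℕ∞) : ℝ≥0∞) ∂P =
      ∫⁻ ω, ∑' i, P {ω' | ((fun j => X j ω), ((fun j => act j ω'),
        fun l : ℕ × ℕ => H l.1 l.2 ω')) ∈ E i} ∂P := by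
  classical
  have hY := hnet.measurable_act.prodMk hnet.measurable_gain
  simp only [encard_toENNReal_eq_tsum]
  have hm : ∀ i, MeasurableSet {ω | ((fun j => X j ω), ((fun j => act j ω),
      fun l : ℕ × ℕ => H l.1 l.2 ω)) ∈ E i} := fun i =>
    (hnet.measurable_position.prodMk hY) (hE i)
  rw [lintegral_tsum fun i => (Measurable.ite (hm i) measurable_const measurable_const).aemeasurable,
    lintegral_tsum fun i => (measurable_measure_section hnet.measurable_position hY
      (hE i)).aemeasurable]
  refine tsum_congr fun i => ?_
  rw [← hnet.indep_position.measure_mem_eq_lintegral hnet.measurable_position hY (hE i),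
    ← lintegral_indicator_one (hm i)]
  exact lintegral_congr fun ω => by simp [indicator_apply]

end IsSLPNetwork

namespace SLPParams

variable (p : SLPParams)

theorem measurableSet_probeSegment : MeasurableSet p.probeSegment := measurableSet_Ico

theorem interference_coChannel_eq {n : ℕ} (hn : p.dA + p.rbc + p.dmax < n * p.dA) (x' : ℕ → ℝ)
    (a : ℕ → Bool) (h : ℕ → ℝ) (i : ℕ) (hi : x' i ∈ p.probeSegment) :
    p.interference (p.coChannel n) x' a h i (x' i + p.rbc) =
      p.interference p.probeSegment x' a h i (x' i + p.rbc) := by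
  classical
  have hr := p.rbc_pos
  have hA := p.dA_pos
  refine tsum_congr fun j => ?_
  have hiff : (x' j ∈ p.coChannel n ∧ x' j ∈ Metric.closedBall (x' i + p.rbc) p.dmax) ↔
      (x' j ∈ p.probeSegment ∧ x' j ∈ Metric.closedBall (x' i + p.rbc) p.dmax) := by
    refine and_congr_left fun hball => ?_
    rw [Real.closedBall_eq_Icc] at hball
    constructor
    · intro hj
      obtain ⟨c, hc⟩ := mem_iUnion.1 hj
      rw [segment] at hc
      rw [probeSegment] at hi
      have hnd : 0 < (n : ℝ) * p.dA := by linarith [p.dmax_pos]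
      rcases lt_trichotomy c 0 with h0 | h0 | h0
      · have h1 : (c : ℝ) ≤ -1 := by exact_mod_cast Int.le_sub_one_of_lt h0
        have h2 : (c : ℝ) * n * p.dA ≤ -1 * (n * p.dA) := by
          rw [mul_assoc]; exact mul_le_mul_of_nonneg_right h1 hnd.le
        linarith [hc.2, hball.1, hi.1]
      · subst h0
        simpa [probeSegment] using hc
      · have h1 : (1 : ℝ) ≤ c := by exact_mod_cast h0
        have h2 : 1 * (n * p.dA) ≤ (c : ℝ) * n * p.dA := by
          rw [mul_assoc]; exact mul_le_mul_of_nonneg_right h1 hnd.le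
        linarith [hc.1, hball.2, hi.2]
    · intro hj
      refine mem_iUnion.2 ⟨0, ?_⟩
      simpa [probeSegment, segment] using hj
  exact if_congr (and_congr_right fun _ => and_congr_right fun _ => hiff) rfl rfl

theorem eventually_lt_natCast_mul_dA : ∀ᶠ n : ℕ in atTop, p.dA + p.rbc + p.dmax < n * p.dA :=
  (tendsto_natCast_atTop_atTop.atTop_mul_const p.dA_pos).eventually_gt_atTop _

/-- The Laplace variable at which the interference is evaluated. -/
def laplaceVar : ℝ := p.γ / p.ρ * (p.τ * p.rbc) ^ p.α

theorem laplaceVar_pos : 0 < p.laplaceVar := by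
  have := p.γ_pos; have := p.ρ_pos; have := p.τ_pos; have := p.rbc_pos
  unfold laplaceVar; positivity

theorem pathGain_of_pos {r : ℝ} (hr : 0 < r) :
    p.pathGain r = ENNReal.ofReal ((p.τ * r) ^ (-p.α)) :=
  ENNReal.ofReal_rpow_of_pos (mul_pos p.τ_pos hr)

theorem pathGain_zero : p.pathGain 0 = ⊤ := by
  rw [pathGain, mul_zero, ENNReal.ofReal_zero, ENNReal.zero_rpow_of_neg (neg_neg_of_pos p.α_pos)]

theorem lt_sinr_iff (n : ℕ) (x' : ℕ → ℝ) (a : ℕ → Bool) (h : ℕ → ℝ) (i : ℕ) :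
    ENNReal.ofReal p.γ < p.sinr n x' a h i (x' i + p.rbc) ↔
      ENNReal.ofReal p.laplaceVar * (p.interference (p.coChannel n) x' a h i (x' i + p.rbc) +
        ENNReal.ofReal (p.σn ^ 2)) < ENNReal.ofReal (h i) := by
  have hγ := p.γ_pos
  have hρ := p.ρ_pos
  have hr := p.rbc_pos
  have hτ := p.τ_pos
  have hdist : |x' i - (x' i + p.rbc)| = p.rbc := by
    rw [sub_add_cancel_left, abs_neg, abs_of_pos hr]
  set g : ℝ := (p.τ * p.rbc) ^ (-p.α) * p.ρ with hg
  have hg0 : 0 < g := by positivity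
  have hs : p.γ = p.laplaceVar * g := by
    rw [laplaceVar, hg, Real.rpow_neg (by positivity)]
    have : (p.τ * p.rbc) ^ p.α ≠ 0 := by positivity
    field_simp
  have hγ0 : ENNReal.ofReal p.γ ≠ 0 := by simpa using hγ
  rw [sinr, hdist, p.pathGain_of_pos hr, mul_assoc, ← ENNReal.ofReal_mul (by positivity), ← hg,
    ENNReal.lt_div_iff_mul_lt (Or.inr ENNReal.ofReal_ne_top) (Or.inr hγ0), hs,
    ENNReal.ofReal_mul p.laplaceVar_pos.le, mul_assoc,
    mul_comm (ENNReal.ofReal g), ← mul_assoc]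
  exact ENNReal.mul_lt_mul_iff_left (by simpa using hg0) ENNReal.ofReal_ne_top

theorem captureProb_eq_of_lt {Ω : Type*} [MeasurableSpace Ω] (P : Measure Ω) (X : ℕ → Ω → ℝ)
    (act : ℕ → Ω → Bool) (H : ℕ → ℕ → Ω → ℝ) {n : ℕ}
    (hn : p.dA + p.rbc + p.dmax < n * p.dA) :
    p.captureProb P X act H n =
      (∫⁻ ω, ({i : ℕ | act i ω = true ∧ X i ω ∈ p.probeSegment ∧
        ENNReal.ofReal p.laplaceVar * (p.interference p.probeSegment (fun j => X j ω)
          (fun j => act j ω) (fun j => H i j ω) i (X i ω + p.rbc) + ENNReal.ofReal (p.σn ^ 2)) <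
            ENNReal.ofReal (H i i ω)}.encard : ℝ≥0∞) ∂P) /
      (∫⁻ ω, ({i : ℕ | act i ω = true ∧ X i ω ∈ p.probeSegment}.encard : ℝ≥0∞) ∂P) := by
  rw [captureProb]
  congr 1
  refine lintegral_congr fun ω => ?_
  congr 3
  ext i
  refine and_congr_right fun _ => and_congr_right fun hi => ?_
  rw [p.lt_sinr_iff n (fun j => X j ω) (fun j => act j ω) (fun j => H i j ω) i,
    p.interference_coChannel_eq hn _ _ _ _ hi]

/-- The factor contributed by a vehicle at `x` to the capture probability of a transmitter at `y`:
one minus the activity probability times the interference weight. -/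
def captureFactor (y x : ℝ) : ℝ :=
  1 - p.pa * (Metric.closedBall (y + p.rbc) p.dmax).indicator
    (fun x => p.weight p.laplaceVar |x - (y + p.rbc)|) x

theorem indicator_weight_mem_Icc (y x : ℝ) :
    (Metric.closedBall y p.dmax).indicator (fun x => p.weight p.laplaceVar |x - y|) x ∈
      Icc (0 : ℝ) 1 := by
  by_cases hx : x ∈ Metric.closedBall y p.dmax
  · rw [indicator_of_mem hx]
    exact ⟨p.weight_nonneg p.laplaceVar_pos (abs_nonneg _),
      p.weight_le_one p.laplaceVar_pos (abs_nonneg _)⟩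
  · rw [indicator_of_notMem hx]
    exact ⟨le_rfl, zero_le_one⟩

theorem captureFactor_mem_Icc (y x : ℝ) : p.captureFactor y x ∈ Icc (0 : ℝ) 1 := by
  have h := p.indicator_weight_mem_Icc (y + p.rbc) x
  have h1 := mul_nonneg p.pa_pos.le h.1
  have h2 := mul_le_one₀ p.pa_le_one h.1 h.2
  exact ⟨sub_nonneg.2 h2, sub_le_self _ h1⟩

theorem continuous_weight_abs : Continuous fun q : ℝ × ℝ =>
    p.weight p.laplaceVar |q.2 - (q.1 + p.rbc)| :=
  (p.continuousOn_weight p.laplaceVar_pos).comp_continuous (by fun_prop)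
    fun q => abs_nonneg (q.2 - (q.1 + p.rbc))

theorem ae_continuousAt_captureFactor (y : ℝ) :
    ∀ᵐ x, ContinuousAt (fun q : ℝ × ℝ => p.captureFactor q.1 q.2) (y, x) := by
  have hnull : ∀ᵐ x : ℝ, x ∉ ({y + p.rbc - p.dmax, y + p.rbc + p.dmax} : Set ℝ) :=
    (Set.Finite.countable (by simp)).ae_notMem _
  filter_upwards [hnull] with x hx
  have hne : dist x (y + p.rbc) ≠ p.dmax := by
    rintro h
    rw [Real.dist_eq] at h
    refine hx ?_
    rcases abs_choice (x - (y + p.rbc)) with h1 | h1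
    · exact Or.inr (by rw [mem_singleton_iff]; linarith)
    · exact Or.inl (by linarith)
  have hd : Continuous fun q : ℝ × ℝ => dist q.2 (q.1 + p.rbc) := by fun_prop
  refine continuousAt_const.sub (continuousAt_const.mul ?_)
  rcases lt_or_gt_of_ne hne with h | h
  · refine (p.continuous_weight_abs.continuousAt (x := (y, x))).congr ?_
    filter_upwards [hd.continuousAt.eventually_lt continuousAt_const h] with q hq
    rw [indicator_of_mem (Metric.mem_closedBall.2 hq.le)]
  · refine (continuousAt_const (y := (0 : ℝ))).congr ?_
    filter_upwards [continuousAt_const.eventually_lt hd.continuousAt h] with q hq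
    rw [indicator_of_notMem fun hm => (not_le.2 hq) (Metric.mem_closedBall.1 hm)]

theorem inv_one_add_eq_weight {t : ℝ} (ht : 0 ≤ t) :
    (1 + ENNReal.ofReal p.laplaceVar * (p.pathGain t * ENNReal.ofReal p.ρ))⁻¹ =
      ENNReal.ofReal (1 - p.weight p.laplaceVar t) := by
  have hs := p.laplaceVar_pos
  have hρ := p.ρ_pos
  have hτ := p.τ_pos
  rcases ht.eq_or_lt with h | h
  · subst h
    rw [pathGain_zero, ENNReal.top_mul (by simpa using hρ), ENNReal.mul_top (by simpa using hs),
      add_top, ENNReal.inv_top, weight, mul_zero, Real.zero_rpow p.α_pos.ne', add_zero,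
      div_self (by positivity), sub_self, ENNReal.ofReal_zero]
  · rw [p.pathGain_of_pos h, ← ENNReal.ofReal_mul (by positivity), ← ENNReal.ofReal_mul hs.le,
      ← ENNReal.ofReal_one, ← ENNReal.ofReal_add zero_le_one (by positivity),
      ← ENNReal.ofReal_inv_of_pos (by positivity)]
    congr 1
    rw [weight, Real.rpow_neg (by positivity)]
    have : 0 < (p.τ * t) ^ p.α := by positivity
    field_simp
    ring

open Classical in
theorem laplaceVar_mul_interference (x' : ℕ → ℝ) (a : ℕ → Bool) (h : ℕ → ℝ) (i : ℕ)
    (hT : {j | x' j ∈ p.probeSegment}.Finite) :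
    ENNReal.ofReal p.laplaceVar * (p.interference p.probeSegment x' a h i (x' i + p.rbc) +
        ENNReal.ofReal (p.σn ^ 2)) =
      ENNReal.ofReal (p.laplaceVar * p.σn ^ 2) +
      ∑ j ∈ (hT.toFinset.erase i).filter fun j => x' j ∈ Metric.closedBall (x' i + p.rbc) p.dmax,
        (if a j = true then ENNReal.ofReal p.laplaceVar *
          (p.pathGain |x' j - (x' i + p.rbc)| * ENNReal.ofReal p.ρ) else 0) *
          ENNReal.ofReal (h j) := by
  rw [mul_add, ← ENNReal.ofReal_mul p.laplaceVar_pos.le, add_comm, interference,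
    tsum_eq_sum (s := (hT.toFinset.erase i).filter
      fun j => x' j ∈ Metric.closedBall (x' i + p.rbc) p.dmax), Finset.mul_sum]
  · congr 1
    refine Finset.sum_congr rfl fun j hj => ?_
    simp only [Finset.mem_filter, Finset.mem_erase, Set.Finite.mem_toFinset, mem_ofPred_eq] at hj
    simp only [hj.1.1, hj.1.2, hj.2, ne_eq, not_false_eq_true, true_and, and_true]
    split_ifs
    · ring
    · simp
  · intro j hj
    rw [if_neg]
    rintro ⟨h1, -, h3, h4⟩
    exact hj (by simp [h1, h3]; simpa using h4)

variable {Ω : Type*} [MeasurableSpace Ω] {P : Measure Ω} [IsProbabilityMeasure P]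
  {X : ℕ → Ω → ℝ} {act : ℕ → Ω → Bool} {H : ℕ → ℕ → Ω → ℝ}

theorem measure_captured_of_finite (hnet : IsSLPNetwork P p.lam p.pa X act H) (x' : ℕ → ℝ)
    (hT : {j | x' j ∈ p.probeSegment}.Finite) (i : ℕ) :
    P {ω | act i ω = true ∧
        ENNReal.ofReal p.laplaceVar * (p.interference p.probeSegment x'
          (fun j => act j ω) (fun j => H i j ω) i (x' i + p.rbc) + ENNReal.ofReal (p.σn ^ 2)) <
            ENNReal.ofReal (H i i ω)} =
      ENNReal.ofReal p.pa * ENNReal.ofReal (Real.exp (-(p.laplaceVar * p.σn ^ 2))) *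
        ENNReal.ofReal (∏ j ∈ hT.toFinset.erase i, p.captureFactor (x' i) (x' j)) := by
  classical
  have hs := p.laplaceVar_pos
  have hpa := p.pa_pos
  simp only [p.laplaceVar_mul_interference _ _ _ _ hT]
  rw [hnet.measure_active_and_lt_gain ⟨p.pa_pos.le, p.pa_le_one⟩ (by simp)
    (fun j => ENNReal.ofReal p.laplaceVar *
          (p.pathGain |x' j - (x' i + p.rbc)| * ENNReal.ofReal p.ρ)), expNeg_ofReal (by positivity),
    Finset.prod_filter, ENNReal.ofReal_prod_of_nonneg fun j _ => (p.captureFactor_mem_Icc _ _).1]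
  congr 1
  refine Finset.prod_congr rfl fun j _ => ?_
  rw [captureFactor]
  split_ifs with hj
  · rw [indicator_of_mem hj, p.inv_one_add_eq_weight (abs_nonneg _),
      ← ENNReal.ofReal_mul hpa.le, ← ENNReal.ofReal_add]
    · congr 1; ring
    · exact mul_nonneg hpa.le (sub_nonneg.2 (p.weight_le_one hs (abs_nonneg _)))
    · exact sub_nonneg.2 p.pa_le_one
  · rw [indicator_of_notMem hj, mul_zero, sub_zero, ENNReal.ofReal_one]

theorem measurable_pathGain : Measurable p.pathGain := by
  unfold pathGain; fun_prop

theorem measurable_interference {β : Type*} [MeasurableSpace β] {S : Set ℝ} (hS : MeasurableSet S)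
    {x' : β → ℕ → ℝ} {a : β → ℕ → Bool} {h : β → ℕ → ℝ} (hx : Measurable x') (ha : Measurable a)
    (hh : Measurable h) (i : ℕ) :
    Measurable fun q => p.interference S (x' q) (a q) (h q) i (x' q i + p.rbc) := by
  have hxj : ∀ j, Measurable fun q => x' q j := fun j => (measurable_pi_apply j).comp hx
  have haj : ∀ j, Measurable fun q => a q j := fun j => (measurable_pi_apply j).comp ha
  have hhj : ∀ j, Measurable fun q => h q j := fun j => (measurable_pi_apply j).comp hh
  refine Measurable.tsum fun j => Measurable.ite ?_ ?_ measurable_const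
  · refine (MeasurableSet.const _).inter ((measurableSet_eq_fun (haj j) measurable_const).inter
      ((hxj j hS).inter ?_))
    exact measurableSet_le ((hxj j).dist ((hxj i).add_const _)) measurable_const
  · refine ((hhj j).ennreal_ofReal.mul (p.measurable_pathGain.comp ?_)).mul_const _
    exact ((hxj j).sub ((hxj i).add_const _)).abs

theorem lintegral_captured (hnet : IsSLPNetwork P p.lam p.pa X act H) :
    ∫⁻ ω, ({i : ℕ | act i ω = true ∧ X i ω ∈ p.probeSegment ∧
        ENNReal.ofReal p.laplaceVar * (p.interference p.probeSegment (fun j => X j ω)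
          (fun j => act j ω) (fun j => H i j ω) i (X i ω + p.rbc) + ENNReal.ofReal (p.σn ^ 2)) <
            ENNReal.ofReal (H i i ω)}.encard : ℝ≥0∞) ∂P =
      ENNReal.ofReal p.pa * ENNReal.ofReal (Real.exp (-(p.laplaceVar * p.σn ^ 2))) *
        ∫⁻ ω, pairSum p.probeSegment p.captureFactor (fun i => X i ω) ∂P := by
  classical
  set E : ℕ → Set ((ℕ → ℝ) × ((ℕ → Bool) × (ℕ × ℕ → ℝ))) := fun i =>
    {q | q.2.1 i = true ∧ q.1 i ∈ p.probeSegment ∧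
        ENNReal.ofReal p.laplaceVar * (p.interference p.probeSegment q.1
          q.2.1 (fun j => q.2.2 (i, j)) i (q.1 i + p.rbc) + ENNReal.ofReal (p.σn ^ 2)) <
            ENNReal.ofReal (q.2.2 (i, i))} with hEdef
  have hpos : ∀ i, MeasurableSet {q : (ℕ → ℝ) × ((ℕ → Bool) × (ℕ × ℕ → ℝ)) |
      q.1 i ∈ p.probeSegment} := fun i =>
    p.measurableSet_probeSegment.preimage ((measurable_pi_apply i).comp measurable_fst)
  have hE : ∀ i, MeasurableSet (E i) := fun i => by
    have hlt : MeasurableSet {q : (ℕ → ℝ) × ((ℕ → Bool) × (ℕ × ℕ → ℝ)) |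
        ENNReal.ofReal p.laplaceVar * (p.interference p.probeSegment q.1
          q.2.1 (fun j => q.2.2 (i, j)) i (q.1 i + p.rbc) + ENNReal.ofReal (p.σn ^ 2)) <
            ENNReal.ofReal (q.2.2 (i, i))} :=
      measurableSet_lt (((p.measurable_interference p.measurableSet_probeSegment measurable_fst
        (by fun_prop) (by fun_prop) i).add_const _).const_mul _) (by fun_prop)
    exact (measurableSet_eq_fun (by fun_prop) measurable_const).inter ((hpos i).inter hlt)
  have h1 := hnet.lintegral_encard hE
  simp only [hEdef, mem_ofPred_eq] at h1
  rw [h1, ← lintegral_const_mul' _ _ (ENNReal.mul_ne_top ENNReal.ofReal_ne_top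
    ENNReal.ofReal_ne_top)]
  refine lintegral_congr_ae ?_
  filter_upwards [hnet.poisson.ae_finite p.lam_pos.le p.measurableSet_probeSegment
    (Metric.isBounded_Ico _ _)] with ω hω
  rw [pairSum_of_finite _ hω, ENNReal.ofReal_sum_of_nonneg fun i _ =>
    Finset.prod_nonneg fun j _ => (p.captureFactor_mem_Icc _ _).1, Finset.mul_sum,
    tsum_eq_sum (s := hω.toFinset)]
  · refine Finset.sum_congr rfl fun i hi => ?_
    rw [Set.Finite.mem_toFinset] at hi
    rw [← p.measure_captured_of_finite hnet (fun j => X j ω) hω i]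
    have hi' : X i ω ∈ p.probeSegment := hi
    simp only [hi', true_and]
  · intro i hi
    rw [Set.Finite.mem_toFinset] at hi
    have hi' : X i ω ∉ p.probeSegment := hi
    simp [hi']

theorem lintegral_active (hnet : IsSLPNetwork P p.lam p.pa X act H) :
    ∫⁻ ω, ({i : ℕ | act i ω = true ∧ X i ω ∈ p.probeSegment}.encard : ℝ≥0∞) ∂P =
      ENNReal.ofReal p.pa * ENNReal.ofReal (p.lam * p.dA) := by
  classical
  set E : ℕ → Set ((ℕ → ℝ) × ((ℕ → Bool) × (ℕ × ℕ → ℝ))) := fun i =>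
    {q | q.2.1 i = true ∧ q.1 i ∈ p.probeSegment} with hEdef
  have hE : ∀ i, MeasurableSet (E i) := fun i =>
    (measurableSet_eq_fun (by fun_prop) measurable_const).inter
      (p.measurableSet_probeSegment.preimage ((measurable_pi_apply i).comp measurable_fst))
  have h1 := hnet.lintegral_encard hE
  simp only [hEdef, mem_ofPred_eq] at h1
  have h2 := hnet.poisson.lintegral_pairSum p.lam_pos.le
    (a := -(p.dA / 2)) (b := p.dA / 2) (by linarith [p.dA_pos])
    (f := fun _ _ => 1) (fun _ _ => ⟨zero_le_one, le_rfl⟩)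
    (fun _ => Eventually.of_forall fun _ => continuousAt_const)
  simp only [sub_self, integral_zero, mul_zero, neg_zero, Real.exp_zero, mul_one,
    setLIntegral_const, Real.volume_Ico] at h2
  rw [sub_neg_eq_add, add_halves, ← ENNReal.ofReal_mul p.lam_pos.le, ← probeSegment] at h2
  rw [h1, ← h2, ← lintegral_const_mul' _ _ ENNReal.ofReal_ne_top]
  refine lintegral_congr_ae ?_
  filter_upwards [hnet.poisson.ae_finite p.lam_pos.le p.measurableSet_probeSegment
    (Metric.isBounded_Ico _ _)] with ω hω
  rw [pairSum_of_finite _ hω, ENNReal.ofReal_sum_of_nonneg fun i _ =>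
    Finset.prod_nonneg fun j _ => zero_le_one, Finset.mul_sum, tsum_eq_sum (s := hω.toFinset)]
  · refine Finset.sum_congr rfl fun i hi => ?_
    rw [Set.Finite.mem_toFinset] at hi
    have hi' : X i ω ∈ p.probeSegment := hi
    simp only [hi', and_true, Finset.prod_const_one, ENNReal.ofReal_one, mul_one]
    exact hnet.act_prob i
  · intro i hi
    rw [Set.Finite.mem_toFinset] at hi
    have hi' : X i ω ∉ p.probeSegment := hi
    simp [hi']

theorem integral_one_sub_captureFactor (y : ℝ) :
    ∫ x in p.probeSegment, (1 - p.captureFactor y x) =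
      p.pa * p.kappa 0 p.laplaceVar (y + p.rbc) := by
  rw [p.kappa_zero_eq_integral p.laplaceVar_pos, ← integral_const_mul]
  simp only [captureFactor, sub_sub_cancel]

theorem kappa_zero_nonneg (y : ℝ) : 0 ≤ p.kappa 0 p.laplaceVar y := by
  rw [p.kappa_zero_eq_integral p.laplaceVar_pos]
  exact integral_nonneg fun x => (p.indicator_weight_mem_Icc y x).1

theorem measurable_kappa_zero : Measurable fun y => p.kappa 0 p.laplaceVar (y + p.rbc) := by
  simp only [p.kappa_zero_eq_integral p.laplaceVar_pos]
  refine StronglyMeasurable.measurable ?_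
  refine StronglyMeasurable.integral_prod_right (f := fun y x =>
    (Metric.closedBall (y + p.rbc) p.dmax).indicator
      (fun x => p.weight p.laplaceVar |x - (y + p.rbc)|) x) ?_
  refine Measurable.stronglyMeasurable ?_
  have h : MeasurableSet {q : ℝ × ℝ | dist q.2 (q.1 + p.rbc) ≤ p.dmax} :=
    measurableSet_le (by fun_prop) measurable_const
  exact p.continuous_weight_abs.measurable.indicator h

theorem lintegral_pairSum_captureFactor (hnet : IsSLPNetwork P p.lam p.pa X act H) :
    ∫⁻ ω, pairSum p.probeSegment p.captureFactor (fun i => X i ω) ∂P =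
      ENNReal.ofReal (p.lam * ∫ v in (-(p.dA / 2))..(p.dA / 2),
        Real.exp (-(p.lam * p.pa * p.kappa 0 p.laplaceVar (v + p.rbc)))) := by
  have hlam := p.lam_pos
  have hA := p.dA_pos
  have h := hnet.poisson.lintegral_pairSum hlam.le
    (a := -(p.dA / 2)) (b := p.dA / 2) (by linarith) p.captureFactor_mem_Icc
    p.ae_continuousAt_captureFactor
  rw [← probeSegment] at h
  simp only [p.integral_one_sub_captureFactor] at h
  rw [h, intervalIntegral.integral_of_le (by linarith), ← integral_Ico_eq_integral_Ioc,
    ← integral_const_mul, ofReal_integral_eq_lintegral_ofReal]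
  · simp only [probeSegment, mul_assoc]
  · have hfin : IsFiniteMeasure (volume.restrict (Ico (-(p.dA / 2)) (p.dA / 2))) :=
      ⟨by simp⟩
    refine (Integrable.of_bound (C := 1) ?_ (Eventually.of_forall fun v => ?_)).const_mul p.lam
    · have := p.measurable_kappa_zero
      exact Measurable.aestronglyMeasurable (by fun_prop)
    · rw [Real.norm_of_nonneg (Real.exp_pos _).le, Real.exp_le_one_iff, neg_nonpos]
      exact mul_nonneg (mul_nonneg hlam.le p.pa_pos.le) (p.kappa_zero_nonneg _)
  · exact Eventually.of_forall fun v => mul_nonneg hlam.le (Real.exp_pos _).le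

theorem captureProb_eq (hnet : IsSLPNetwork P p.lam p.pa X act H) {n : ℕ}
    (hn : p.dA + p.rbc + p.dmax < n * p.dA) :
    p.captureProb P X act H n = ENNReal.ofReal
      (Real.exp (-(p.γ * p.σn ^ 2 / p.ρ * (p.τ * p.rbc) ^ p.α)) / p.dA *
        ∫ v in (-(p.dA / 2))..(p.dA / 2),
          Real.exp (-(p.lam * p.pa *
            p.kappa 0 (p.γ / p.ρ * (p.τ * p.rbc) ^ p.α) (v + p.rbc)))) := by
  have hlam := p.lam_pos
  have hA := p.dA_pos
  have hpa := p.pa_pos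
  rw [p.captureProb_eq_of_lt P X act H hn, p.lintegral_captured hnet, p.lintegral_active hnet,
    p.lintegral_pairSum_captureFactor hnet, ← ENNReal.ofReal_mul hpa.le,
    ← ENNReal.ofReal_mul hpa.le, ← ENNReal.ofReal_mul (by positivity),
    ← ENNReal.ofReal_div_of_pos (by positivity)]
  congr 1
  have h1 : p.laplaceVar * p.σn ^ 2 = p.γ * p.σn ^ 2 / p.ρ * (p.τ * p.rbc) ^ p.α := by
    rw [laplaceVar]; ring
  rw [h1, ← laplaceVar]
  field_simp

end SLPParams

end

theorem corollary1 {Ω : Type*} [MeasurableSpace Ω] (P : Measure Ω) [IsProbabilityMeasure P]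
    (p : SLPParams) (X : ℕ → Ω → ℝ) (act : ℕ → Ω → Bool) (H : ℕ → ℕ → Ω → ℝ)
    (hnet : IsSLPNetwork P p.lam p.pa X act H) :
    -- the capture probability converges to the noise factor times the segment average
    Tendsto (fun n : ℕ => p.captureProb P X act H n) atTop
      (𝓝 (ENNReal.ofReal
        (Real.exp (-(p.γ * p.σn ^ 2 / p.ρ * (p.τ * p.rbc) ^ p.α)) / p.dA *
          ∫ v in (-(p.dA / 2))..(p.dA / 2),
            Real.exp (-(p.lam * p.pa *
              p.kappa 0 (p.γ / p.ρ * (p.τ * p.rbc) ^ p.α) (v + p.rbc)))))) ∧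
    -- for large `n`, the interference comes from the probe segment (`c = 0`) only
    (∀ᶠ n : ℕ in atTop, ∀ (i : ℕ) (ω : Ω), X i ω ∈ p.probeSegment →
      p.interference (p.coChannel n) (fun j => X j ω) (fun j => act j ω) (fun j => H i j ω) i
          (X i ω + p.rbc) =
        p.interference p.probeSegment (fun j => X j ω) (fun j => act j ω) (fun j => H i j ω) i
          (X i ω + p.rbc)) := by
  refine ⟨tendsto_const_nhds.congr' ?_, ?_⟩
  · filter_upwards [p.eventually_lt_natCast_mul_dA] with n hn
    exact (p.captureProb_eq hnet hn).symm
  · filter_upwards [p.eventually_lt_natCast_mul_dA] with n hn i ω hi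
    exact p.interference_coChannel_eq hn (fun j => X j ω) _ _ i hi
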